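/- **Setup.** Let $V$ be a finite-dimensional complex vector space. A compactly supported field of the holomorphic bosonic string on $\mathbb C$ with target $V$ is a quadruple $(\gamma,\beta,c,b)$ of compactly supported smooth forms $$\gamma\in\Omega^{0,*}_c(\mathbb C)\otimes V,\quad \beta\in\Omega^{1,*}_c(\mathbb C)\otimes V^\vee,\quad c\in\Omega^{0,*}_c(\mathbb C,T^{1,0}),\quad b\in\Omega^{1,*}_c(\mathbb C,T^{1,0*}),$$ written in the frames $dz$, $\partial_z$; thus each of them has the form $f_0+f_1\,d\bar z$ times the frame. The interaction is $I_{\rm string}=\int\langle\beta,[c,\gamma]\rangle+\int\langle b,[c,c]\rangle$, where $[c,\gamma]=c\,\partial_z\gamma$ and $[c,c']=c\,\partial_zc'-(\partial_zc)\,c'$ in the frame $\partial_z$. **Graphs.** ${\bf Graph}_{\rm string}$ is the set of connected finite graphs $\Gamma$ that have first Betti number $0$ (trees) or $1$ (one-loop graphs), at least one vertex, possibly external legs, and are built as follows. Every vertex is trivalent, with half-edges labelled $(\beta,c,\gamma)$ or $(b,c,c)$, of which the first is outgoing and the other two are incoming. Every internal edge joins an outgoing $\beta$ to an incoming $\gamma$,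 or an outgoing $b$ to an incoming $c$; edges from a vertex to itself are allowed. The half-edges that do not belong to an internal edge are the external legs. **Propagator.** For $0<\ell<L$ let $$P_\ell^L(z,w)=\Big(\int_\ell^L -2\,\partial_z\Big(\frac{1}{4\pi t}e^{-|z-w|^2/4t}\Big)dt\Big)(dz-dw)=\Big(\int_\ell^L\frac1{4\pi t}\,\frac{\bar z-\bar w}{2t}\,e^{-|z-w|^2/4t}\,dt\Big)(dz-dw);$$ denote by $p_\ell^L(z,w)$ its coefficient. An internal $\beta\gamma$ edge carries $P_\ell^L\otimes{\rm id}_V$, and an internal $bc$ edge carries the same coefficient $p_\ell^L$ in the frames above. **Weights.** For $\Gamma$ with $n$ vertices and $k$ external legs, $w_\Gamma(P_\ell^L,I_{\rm string})$ is the following functional of $k$ compactly supported fields, one for each leg; at a leg one uses the component of the field that the label of the leg names. Put the vertices at points $z_1,\dots,z_n\in\mathbb C$. At each vertex apply the operation $\langle\beta,[c,\gamma]\rangle$ or $\langle b,[c,c']\rangle$ to what its three half-edges supply: the input at an external leg, and, for an internal edge from a vertex at $z_u$ to a vertex at $z_v$, the kernel $p_\ell^L(z_u,x)$ as a function of the position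 $x$ of the head, evaluated with its derivatives at $x=z_v$. Contract the $V$ and $V^\vee$ indices, take the product over all vertices with the Koszul signs, and integrate the component of top degree, the coefficient of $\prod_v dz_v\wedge d\bar z_v$, over $\mathbb C^n$. As the propagator contains no $d\bar z$, only those components of the inputs contribute for which each vertex carries exactly one $d\bar z$ from its external legs. **Proposition.** Let $\Gamma\in{\bf Graph}_{\rm string}$ be a tree or a one-loop graph and let $L>0$. For $0<\ell<L$ the integral over $\mathbb C^n$ that defines $w_\Gamma(P_\ell^L,I_{\rm string})$ converges absolutely on all inputs, and there is a (finite) multilinear functional $w_\Gamma(P_0^L,I_{\rm string})$ of $k$ compactly supported fields such that $$\lim_{\ell\to0^+}w_\Gamma(P_\ell^L,I_{\rm string})(\varphi_1,\dots,\varphi_k)=w_\Gamma(P_0^L,I_{\rm string})(\varphi_1,\dots,\varphi_k)$$ for all compactly supported fields $\varphi_1,\dots,\varphi_k$. In particular no counterterms are needed. -/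

import Mathlib

open scoped ContDiff ComplexConjugate

namespace HolomorphicString

/-! ## Fields on the source `ℂ` -/

/-- The four kinds of fields. -/
inductive FieldKind
  | gamma
  | beta
  | c
  | b
  deriving DecidableEq

/-- Compactly supported smooth Dolbeault forms `f₀ + f₁ dz̄` on `ℂ` with coefficients in `E`:
`f 0` is the coefficient in `Ω^{0,0}` and `f 1` is the coefficient of `dz̄`. Sections of
`T^{1,0}`, `Ω^{1,0}`, `Ω^{1,0} ⊗ T^{1,0 *}` are written in the frames `∂_z`, `dz`, `dz ⊗ dz`. -/
def dolbeaultForms (E : Type*) [NormedAddCommGroup E] [NormedSpace ℂ E] :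
    Submodule ℂ (Fin 2 → ℂ → E) where
  carrier := {f | ∀ q, ContDiff ℝ ∞ (f q) ∧ HasCompactSupport (f q)}
  zero_mem' := fun _ => ⟨contDiff_const, HasCompactSupport.zero⟩
  add_mem' := fun hf hg q => ⟨(hf q).1.add (hg q).1, (hf q).2.add (hg q).2⟩
  smul_mem' := fun r _ hf q =>
    ⟨contDiff_const.smul (hf q).1, HasCompactSupport.smul_left (f := fun _ => r) (hf q).2⟩

/-- The space of all compactly supported fields `(γ, β, c, b)`, with target `V`:
`γ ∈ Ω^{0,*} ⊗ V`, `β ∈ Ω^{1,*} ⊗ V^∨`, `c ∈ Ω^{0,*}(T^{1,0})`, `b ∈ Ω^{1,*}(T^{1,0 *})`. -/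
abbrev Fields (V : Type*) [NormedAddCommGroup V] [NormedSpace ℂ V] : Type _ :=
  dolbeaultForms V × dolbeaultForms (V →L[ℂ] ℂ) × dolbeaultForms ℂ × dolbeaultForms ℂ

/-- The scalar coefficient function of the field of kind `τ` in `φ`, in form degree `(·, q)`.
For `γ` and `β` it is the coordinate with index `i` in the basis `e` of `V`, respectively in the
dual basis; the index is not used for `c` and `b`. -/
noncomputable def coefficient {V ι : Type*} [NormedAddCommGroup V] [NormedSpace ℂ V]
    (e : Module.Basis ι ℂ V) (φ : Fields V) (q : Fin 2) : FieldKind → Option ι → ℂ → ℂ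
  | .gamma, some i => fun x => e.repr (φ.1.1 q x) i
  | .beta, some i => fun x => φ.2.1.1 q x (e i)
  | .gamma, none => 0
  | .beta, none => 0
  | .c, _ => φ.2.2.1.1 q
  | .b, _ => φ.2.2.2.1 q

/-- The operator `∂_z = (∂_x - i ∂_y) / 2` on functions on `ℂ`. -/
noncomputable def dz (f : ℂ → ℂ) (x : ℂ) : ℂ :=
  (fderiv ℝ f x 1 - Complex.I * fderiv ℝ f x Complex.I) / 2

/-! ## The regularised propagator -/

/-- The coefficient of `(dz - dw) ∧ (dz̄ - dw̄)` in the heat kernel `e^{-tD}(z, w)`. -/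
noncomputable def heatKernel (t : ℝ) (z w : ℂ) : ℂ :=
  1 / (4 * Real.pi * t) * Complex.exp (-(‖z - w‖ : ℂ) ^ 2 / (4 * t))

/-- The coefficient of `dz - dw` in `P_ℓ^L(z, w) = ∂̄^* ∫_ℓ^L e^{-tD}(z, w) dt`, where
`∂̄^*` acts on coefficients as `-2 ∂_z`. -/
noncomputable def propagator (ℓ L : ℝ) (z w : ℂ) : ℂ :=
  ∫ t in ℓ..L, -2 * dz (fun x => heatKernel t x w) z

theorem dz_heatKernel {t : ℝ} (z w : ℂ) :
    -2 * dz (fun x => heatKernel t x w) z =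
      1 / (4 * Real.pi * t) * ((conj z - conj w) / (2 * t)) *
        Complex.exp (-(‖z - w‖ : ℂ) ^ 2 / (4 * t)) := by
  have key : (fun x => heatKernel t x w) = fun x : ℂ =>
      1 / (4 * Real.pi * t) * Complex.exp (-((x - w) * (conj x - conj w)) / (4 * t)) := by
    funext x
    have : (x - w) * (conj x - conj w) = (‖x - w‖ : ℂ) ^ 2 := by
      rw [← map_sub, Complex.mul_conj']
    rw [this]; rfl
  have hd : HasFDerivAt (fun x : ℂ => (x - w) * (conj x - conj w))
      ((z - w) • (Complex.conjCLE : ℂ →L[ℝ] ℂ) + (conj z - conj w) • ContinuousLinearMap.id ℝ ℂ)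
      z := by
    have h1 : HasFDerivAt (fun x : ℂ => x - w) (ContinuousLinearMap.id ℝ ℂ) z :=
      (hasFDerivAt_id z).sub_const w
    have h2 : HasFDerivAt (fun x : ℂ => conj x - conj w) (Complex.conjCLE : ℂ →L[ℝ] ℂ) z :=
      (Complex.conjCLE : ℂ →L[ℝ] ℂ).hasFDerivAt.sub_const (conj w)
    exact h1.mul h2
  have he := ((hd.neg.mul_const ((4 * (t : ℂ))⁻¹)).cexp).const_mul (1 / (4 * Real.pi * t : ℂ))
  simp only [← div_eq_mul_inv] at he
  have he' := HasFDerivAt.fderiv (f := fun x : ℂ =>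
      1 / (4 * Real.pi * t) * Complex.exp (-((x - w) * (conj x - conj w)) / (4 * t))) he
  have hn : (z - w) * (conj z - conj w) = (‖z - w‖ : ℂ) ^ 2 := by
    rw [← map_sub, Complex.mul_conj']
  rw [key, dz, he', ← hn]
  simp
  ring_nf
  simp
  ring

/-! ## Feynman graphs -/

/-- The two cubic terms of the action: `matter` is `∫ ⟨β, [c, γ]⟩`, `ghost` is `∫ ⟨b, [c, c]⟩`. -/
inductive VertexKind
  | matter
  | ghost
  deriving DecidableEq

/-- The fields labelling the three half-edges at a vertex; the half-edge `0` is the outgoing one,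
the half-edges `1` and `2` are incoming. -/
def VertexKind.field : VertexKind → Fin 3 → FieldKind
  | .matter => ![.beta, .c, .gamma]
  | .ghost => ![.b, .c, .c]

/-- A graph built from the vertices and edges allowed by the action. The vertices are
`0, …, n - 1`, and the half-edges are the pairs (vertex, slot). The involution `flip` exchanges
the two half-edges of every internal edge and fixes the external legs. An internal edge either
flows from `β` to `γ` or from `b` to `c`. -/
structure StringGraph where
  n : ℕ
  kind : Fin n → VertexKind
  flip : Fin n × Fin 3 → Fin n × Fin 3
  flip_flip : ∀ h, flip (flip h) = h
  edge_kind : ∀ h, flip h ≠ h →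
    ((kind h.1).field h.2, (kind (flip h).1).field (flip h).2) ∈
      ({(.beta, .gamma), (.gamma, .beta), (.b, .c), (.c, .b)} : Set (FieldKind × FieldKind))

namespace StringGraph

variable (Γ : StringGraph)

/-- Half-edges. -/
abbrev HalfEdge : Type := Fin Γ.n × Fin 3

/-- External legs. -/
abbrev Leg : Type := {h : Γ.HalfEdge // Γ.flip h = h}

/-- The field labelling a half-edge. -/
def field (h : Γ.HalfEdge) : FieldKind := (Γ.kind h.1).field h.2

/-- The simple graph of adjacent vertices. -/
def adjacency : SimpleGraph (Fin Γ.n) :=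
  SimpleGraph.fromRel fun v w => ∃ s s', Γ.flip (v, s) = (w, s')

/-- The number of internal edges. Every internal edge has exactly one outgoing half-edge, and the
outgoing half-edge of a vertex is its half-edge `0`. -/
def numEdges : ℕ :=
  (Finset.univ.filter fun v : Fin Γ.n => Γ.flip (v, 0) ≠ (v, 0)).card

/-- Connected graphs without loops. -/
def IsTree : Prop := Γ.adjacency.Connected ∧ Γ.numEdges + 1 = Γ.n

/-- Connected graphs with first Betti number one. -/
def IsOneLoop : Prop := Γ.adjacency.Connected ∧ Γ.numEdges = Γ.n

/-! ## Feynman weights -/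

/-- The lexicographic position of a half-edge. -/
def position (h : Γ.HalfEdge) : ℕ := 3 * h.1 + h.2

/-- The position of a half-edge when the half-edges are listed edge by edge, the outgoing end of
each edge first, followed by the external legs in lexicographic order. -/
def contractionPosition (h : Γ.HalfEdge) : ℕ :=
  if Γ.flip h = h then 2 * Γ.n + Γ.position h
  else if h.2 = 0 then 2 * h.1 else 2 * (Γ.flip h).1 + 1

/-- The parity of a field as a superfield: `γ, β` are even and `c, b` are odd. The component of
form degree `(·, q)` has cohomological degree congruent to `parity + q` modulo `2`. -/
def parity : FieldKind → Fin 2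
  | .gamma => 0
  | .beta => 0
  | .c => 1
  | .b => 1

/-- The Koszul sign of reordering the odd half-edges from the list vertex by vertex to the list
edge by edge. -/
def contractionSign : ℤ :=
  (-1) ^ (Finset.univ.filter fun x : Γ.HalfEdge × Γ.HalfEdge =>
    Γ.position x.1 < Γ.position x.2 ∧ Γ.contractionPosition x.2 < Γ.contractionPosition x.1 ∧
      parity (Γ.field x.1) = 1 ∧ parity (Γ.field x.2) = 1).card

/-- The Koszul sign of moving the degrees of the inputs, which are taken in lexicographic order of
the legs, to the left of all `dz̄`; the input at the leg `l` has form degree `(·, q l)`. -/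
def inputSign (q : Γ.Leg → Fin 2) : ℤ :=
  (-1) ^ (Finset.univ.filter fun x : Γ.Leg × Γ.Leg =>
    Γ.position x.1 < Γ.position x.2 ∧ q x.1 = 1 ∧ parity (Γ.field x.2) + q x.2 = 1).card

/-- A choice of form degrees of the inputs for which the integrand is a top form on `ℂ^n`: every
vertex carries exactly one `dz̄`. (The propagators contain no `dz̄`.) -/
def IsTopDegree (q : Γ.Leg → Fin 2) : Prop :=
  ∀ v, ∃! l : Γ.Leg, l.1.1 = v ∧ q l = 1

/-- A choice of basis indices for the contraction of `V` with `V^∨`: one index for every matter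
vertex (`⟨β, [c, γ]⟩` pairs `β` with `γ`), and equal indices at the two ends of every internal
`β γ` edge (the propagator is tensored with the identity of `V`). -/
def IsIndexing {ι : Type*} (a : Fin Γ.n → Option ι) : Prop :=
  (∀ v, (a v).isSome = true ↔ Γ.kind v = .matter) ∧
    ∀ h, Γ.field h = .gamma → a (Γ.flip h).1 = a h.1

section Weight

variable {V ι : Type*} [NormedAddCommGroup V] [NormedSpace ℂ V] [Fintype ι]

/-- What the half-edge `h` feeds into its vertex, as a function of the position `x` of the vertex:
the input if `h` is a leg, and the propagator `P (tail) x` if `h` is the incoming end of an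
internal edge, whose tail is at the position of its vertex. The outgoing end contributes `1`, so
that every edge is counted once. -/
noncomputable def slot (P : ℂ → ℂ → ℂ) (e : Module.Basis ι ℂ V) (φ : Γ.Leg → Fields V)
    (q : Γ.Leg → Fin 2) (a : Fin Γ.n → Option ι) (z : Fin Γ.n → ℂ) (h : Γ.HalfEdge) : ℂ → ℂ :=
  if hh : Γ.flip h = h then coefficient e (φ ⟨h, hh⟩) (q ⟨h, hh⟩) (Γ.field h) (a h.1)
  else if h.2 = 0 then fun _ => 1
  else fun x => P (z (Γ.flip h).1) x

/-- The vertex operators: `⟨β, [c, γ]⟩ = β c ∂_z γ` and `⟨b, [c, c']⟩ = b (c ∂_z c' - ∂_z c c')`,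
evaluated at `x`. -/
noncomputable def vertexValue (k : VertexKind) (f : Fin 3 → ℂ → ℂ) (x : ℂ) : ℂ :=
  match k with
  | .matter => f 0 x * (f 1 x * dz (f 2) x)
  | .ghost => f 0 x * (f 1 x * dz (f 2) x - dz (f 1) x * f 2 x)

open Classical in
/-- The coefficient of `∏ dz_v ∧ dz̄_v` in the form on `ℂ^n` obtained by placing the vertices of
`Γ` at `z`, the interaction terms at the vertices, the propagator `P` on the internal edges and
the inputs `φ` on the legs. -/
noncomputable def integrand (P : ℂ → ℂ → ℂ) (e : Module.Basis ι ℂ V) (φ : Γ.Leg → Fields V)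
    (z : Fin Γ.n → ℂ) : ℂ :=
  Γ.contractionSign *
    ∑ q ∈ Finset.univ.filter Γ.IsTopDegree, Γ.inputSign q *
      ∑ a ∈ Finset.univ.filter fun a : Fin Γ.n → Option ι => Γ.IsIndexing a,
        ∏ v, vertexValue (Γ.kind v) (fun s => Γ.slot P e φ q a z (v, s)) (z v)

/-- The Feynman weight `w_Γ(P, I_string)` on the inputs `φ`; note `dz ∧ dz̄ = -2i dx ∧ dy`. -/
noncomputable def weight (P : ℂ → ℂ → ℂ) (e : Module.Basis ι ℂ V)
    (φ : Γ.Leg → Fields V) : ℂ :=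
  (-2 * Complex.I) ^ Γ.n * ∫ z : Fin Γ.n → ℂ, Γ.integrand P e φ z

end Weight

end StringGraph

end HolomorphicString

/-!
The weight is a finite sum of integrals over the positions `z` of the vertices of a compactly
supported smooth function `F z`, made from the inputs, times one factor for every internal edge:
the propagator or its holomorphic derivative (`prod_vertexValue`). Up to a factor `2`, these are the
integrals over `t ∈ (ℓ, L]` of the heat kernel `K_t(u) = exp (-|u|² / 4t) / (4πt)` times the first
or second power of `ū / 4t`, where `u` is the difference of the ends of the edge
(`propagator_eq`, `dz_propagator`). So a weight is an integral over one time `t_e ∈ (ℓ, L]` for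
every internal edge `e`, and it suffices to bound the integral over the positions at fixed times by an
integrable function of the times in `(0, L]`; dominated convergence then gives the limit
(`isRegular_of_hasHeatBound`).

The powers of `ū_e / 4t_e` are removed by integration by parts. All heat kernels together form a
Gaussian `exp (-∑ |u_e|² / 4t_e)`, and a holomorphic vector field with constant coefficients `a_v`
multiplies it by `-∑ (δa)_e ū_e / 4t_e`, where `(δa)_e` is the difference of `a` along `e`; on the
antiholomorphic polynomial in front it vanishes. On a tree `δa` is arbitrary, so a single factor
`ū_e / 4t_e` can be produced. On a wheel `δa` only has to have sum zero, and since `∑ u_e = 0`, the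
choice `(δa)_e' = δ_{ee'} - t_e' / ∑ t` produces the factor `ū_e / 4t_e`. Its coefficients are
bounded uniformly in the times (`HasBoundedLifts`). Hence all derivatives may be moved to `F`
(`HasHeatBound.heatProd`), and only heat kernels remain.

On a tree the edge differences are coordinates and each heat kernel has mass one, so the bound is a
constant (`hasHeatBound_of_tree`). On a wheel with `n` edges any one of the heat kernels may be
estimated by `1 / (4πt_e)`, which leaves a tree; the geometric mean `C ∏ t_e ^ (-1 / n)` of these
bounds is integrable for `n ≥ 2` (`hasHeatBound_of_wheel`). For `n = 1` the propagator and its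
derivative vanish on the diagonal.

These are the only cases: the integrand is zero unless every vertex carries an external leg, and
then a one-loop graph, which has as many edges as vertices, is a wheel (`bijective_of_legs`). The
limit is multilinear because the regularised weights are.
-/

namespace HolomorphicString

open MeasureTheory Filter Topology Set

/-! ### Holomorphic derivatives of heat kernels -/

/-- The `m`-fold holomorphic derivative of the heat kernel on `ℂ` at time `t`, up to the sign
`(-1) ^ m`, as a function of the difference `u` of the two points. -/
noncomputable def heatDeriv (m : ℕ) (t : ℝ) (u : ℂ) : ℂ :=
  1 / (4 * Real.pi * t) * (conj u / (4 * t)) ^ m * Complex.exp (-(u * conj u) / (4 * t))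

theorem heatDeriv_succ (m : ℕ) (t : ℝ) (u : ℂ) :
    heatDeriv (m + 1) t u = conj u / (4 * t) * heatDeriv m t u := by
  simp only [heatDeriv, pow_succ]; ring

theorem heatDeriv_zero_right {m : ℕ} (hm : m ≠ 0) (t : ℝ) : heatDeriv m t 0 = 0 := by
  simp [heatDeriv, hm]

theorem norm_exp_heat (t : ℝ) (u : ℂ) :
    ‖Complex.exp (-(u * conj u) / (4 * t))‖ = Real.exp (-(1 / (4 * t)) * ‖u‖ ^ 2) := by
  rw [Complex.norm_exp, Complex.mul_conj']
  congr 1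
  have : -(‖u‖ : ℂ) ^ 2 / (4 * t) = ((-(1 / (4 * t)) * ‖u‖ ^ 2 : ℝ) : ℂ) := by
    push_cast; ring
  rw [this, Complex.ofReal_re]

theorem norm_heatDeriv {t : ℝ} (ht : 0 < t) (m : ℕ) (u : ℂ) :
    ‖heatDeriv m t u‖ =
      1 / (4 * Real.pi * t) * (‖u‖ / (4 * t)) ^ m * Real.exp (-(1 / (4 * t)) * ‖u‖ ^ 2) := by
  rw [heatDeriv, norm_mul, norm_mul, norm_exp_heat]
  simp [abs_of_pos ht, abs_of_pos Real.pi_pos]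

theorem norm_heatDeriv_le {t ℓ : ℝ} (hℓ : 0 < ℓ) (h : ℓ ≤ t) (m : ℕ) (u : ℂ) :
    ‖heatDeriv m t u‖ ≤ 1 / (4 * Real.pi * ℓ) * (‖u‖ / (4 * ℓ)) ^ m := by
  have ht : 0 < t := hℓ.trans_le h
  rw [norm_heatDeriv ht]
  have h1 : Real.exp (-(1 / (4 * t)) * ‖u‖ ^ 2) ≤ 1 := by
    rw [Real.exp_le_one_iff, neg_mul, neg_nonpos]; positivity
  calc _ ≤ 1 / (4 * Real.pi * t) * (‖u‖ / (4 * t)) ^ m * 1 := by gcongr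
    _ ≤ _ := by rw [mul_one]; gcongr

@[fun_prop]
theorem measurable_heatDeriv {α : Type*} [MeasurableSpace α] (m : ℕ) {f : α → ℝ} {g : α → ℂ}
    (hf : Measurable f) (hg : Measurable g) : Measurable fun p => heatDeriv m (f p) (g p) := by
  unfold heatDeriv; fun_prop

theorem contDiff_heatDeriv (m : ℕ) (t : ℝ) : ContDiff ℝ ∞ (heatDeriv m t) := by
  have hc : ContDiff ℝ ∞ (fun u : ℂ => conj u) := Complex.conjCLE.contDiff
  unfold heatDeriv
  simp only [div_eq_mul_inv _ (4 * (t : ℂ))]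
  exact (contDiff_const.mul ((hc.mul contDiff_const).pow m)).mul
    ((contDiff_id.mul hc).neg.mul contDiff_const).cexp

/-- The coefficient of `dū` in the derivative of `heatDeriv m t`. -/
noncomputable def heatConjDeriv (m : ℕ) (t : ℝ) (u : ℂ) : ℂ :=
  1 / (4 * Real.pi * t) * (m * (conj u / (4 * t)) ^ (m - 1) / (4 * t)) *
    Complex.exp (-(u * conj u) / (4 * t)) - u / (4 * t) * heatDeriv m t u

theorem hasFDerivAt_heatDeriv (m : ℕ) (t : ℝ) (u : ℂ) :
    HasFDerivAt (heatDeriv m t)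
      ((-heatDeriv (m + 1) t u) • ContinuousLinearMap.id ℝ ℂ +
        heatConjDeriv m t u • (Complex.conjCLE : ℂ →L[ℝ] ℂ)) u := by
  have hc : HasFDerivAt (fun u : ℂ => conj u) (Complex.conjCLE : ℂ →L[ℝ] ℂ) u :=
    (Complex.conjCLE : ℂ →L[ℝ] ℂ).hasFDerivAt
  have h1 := ((hc.mul_const ((4 * (t : ℂ))⁻¹)).pow m).const_mul (1 / (4 * Real.pi * t : ℂ))
  have h2 := (((hasFDerivAt_id (𝕜 := ℝ) u).mul hc).neg.mul_const ((4 * (t : ℂ))⁻¹)).cexp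
  refine (h1.mul h2).congr_fderiv ?_
  ext
  all_goals
    simp [heatDeriv, heatConjDeriv, div_eq_mul_inv]
    ring

/-! ### Wirtinger derivatives on `ℂ^X` -/

section Wirtinger

variable {X : Type*}

/-- The holomorphic directional derivative `∑ v, a v * ∂_{z v}` at `z`. -/
noncomputable def wirtinger (f : (X → ℂ) → ℂ) (a z : X → ℂ) : ℂ :=
  (fderiv ℝ f z a - Complex.I * fderiv ℝ f z (Complex.I • a)) / 2

theorem wirtinger_add (f : (X → ℂ) → ℂ) (a b z : X → ℂ) :
    wirtinger f (a + b) z = wirtinger f a z + wirtinger f b z := by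
  simp only [wirtinger, smul_add, map_add]; ring

theorem wirtinger_smul (f : (X → ℂ) → ℂ) (c : ℂ) (a z : X → ℂ) :
    wirtinger f (c • a) z = c * wirtinger f a z := by
  have h1 : c • a = c.re • a + c.im • (Complex.I • a) := by
    ext v
    simp only [Pi.smul_apply, Pi.add_apply, smul_eq_mul, Complex.real_smul]
    conv_lhs => rw [← Complex.re_add_im c]
    ring
  have h2 : Complex.I • c • a = c.re • (Complex.I • a) - c.im • a := by
    ext v
    simp only [Pi.smul_apply, Pi.sub_apply, smul_eq_mul, Complex.real_smul]
    conv_lhs => rw [← Complex.re_add_im c]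
    linear_combination (c.im : ℂ) * a v * Complex.I_sq
  rw [wirtinger, wirtinger, h2, h1]
  simp only [map_add, map_sub, map_smul, Complex.real_smul]
  conv_rhs => rw [← Complex.re_add_im c]
  linear_combination ((c.im : ℂ) * fderiv ℝ f z (Complex.I • a) / 2) * Complex.I_sq

theorem wirtinger_eq_sum [Fintype X] [DecidableEq X] (f : (X → ℂ) → ℂ) (a z : X → ℂ) :
    wirtinger f a z = ∑ v, a v * wirtinger f (Pi.single v 1) z := by
  let φ : (X → ℂ) →ₗ[ℂ] ℂ :=
    { toFun := fun a => wirtinger f a z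
      map_add' := fun a b => wirtinger_add f a b z
      map_smul' := fun c a => wirtinger_smul f c a z }
  have := φ.pi_apply_eq_sum_univ a
  rw [show wirtinger f a z = φ a from rfl, this]
  refine Finset.sum_congr rfl fun v _ => ?_
  rw [smul_eq_mul, show wirtinger f (Pi.single v 1) z = φ (Pi.single v 1) from rfl]
  congr 2
  ext w
  simp [Pi.single_apply, eq_comm]

theorem hasCompactSupport_wirtinger {f : (X → ℂ) → ℂ} (hf : HasCompactSupport f) (a : X → ℂ) :
    HasCompactSupport (wirtinger f a) := by
  refine hf.fderiv (𝕜 := ℝ) |>.mono fun z hz => ?_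
  contrapose! hz
  simp only [Function.mem_support, not_not] at hz
  simp [wirtinger, hz]

variable {E : Type*} [Fintype E]

/-- The product over the edges `e` of derivatives of the heat kernel at time `τ e`, of order
`m e`, where the difference of the ends of `e` is the linear function `d · e` of the positions. -/
noncomputable def heatProd (d : (X → ℂ) →L[ℂ] (E → ℂ)) (m : E → ℕ) (τ : E → ℝ) (z : X → ℂ) : ℂ :=
  ∏ e, heatDeriv (m e) (τ e) (d z e)

theorem heatProd_add_single [DecidableEq E] (d : (X → ℂ) →L[ℂ] (E → ℂ)) (m : E → ℕ) (e : E)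
    (τ : E → ℝ) (z : X → ℂ) :
    heatProd d (m + (Pi.single e 1 : E → ℕ)) τ z = conj (d z e) / (4 * τ e) * heatProd d m τ z := by
  rw [heatProd, heatProd, ← Finset.mul_prod_erase _ _ (Finset.mem_univ e),
    ← Finset.mul_prod_erase _ _ (Finset.mem_univ e), Pi.add_apply, Pi.single_eq_same,
    heatDeriv_succ, mul_assoc]
  congr 2
  refine Finset.prod_congr rfl fun e' he' => ?_
  simp [Finset.ne_of_mem_erase he']

variable [Fintype X]

theorem contDiff_wirtinger {f : (X → ℂ) → ℂ} (hf : ContDiff ℝ ∞ f) (a : X → ℂ) :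
    ContDiff ℝ ∞ (wirtinger f a) := by
  have h : ∀ b : X → ℂ, ContDiff ℝ ∞ fun z => fderiv ℝ f z b := fun b =>
    (hf.fderiv_right (m := ∞) (by simp)).clm_apply contDiff_const
  exact ((h a).sub (contDiff_const.mul (h _))).div_const 2

/-- Integration by parts for holomorphic derivatives. -/
theorem integral_mul_wirtinger {F Q : (X → ℂ) → ℂ} (hF : ContDiff ℝ ∞ F)
    (hFc : HasCompactSupport F) (hQ : ContDiff ℝ ∞ Q) (a : X → ℂ) :
    ∫ z, F z * wirtinger Q a z = -∫ z, wirtinger F a z * Q z := by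
  have hF' : ∀ b : X → ℂ, Continuous fun z => fderiv ℝ F z b := fun b =>
    ((hF.fderiv_right (m := ∞) (by simp)).clm_apply contDiff_const).continuous
  have hQ' : ∀ b : X → ℂ, Continuous fun z => fderiv ℝ Q z b := fun b =>
    ((hQ.fderiv_right (m := ∞) (by simp)).clm_apply contDiff_const).continuous
  have i1 : ∀ b : X → ℂ, Integrable fun z => fderiv ℝ F z b * Q z := fun b =>
    ((hF' b).mul hQ.continuous).integrable_of_hasCompactSupport
      ((hFc.fderiv_apply (𝕜 := ℝ) b).mul_right)
  have i2 : ∀ b : X → ℂ, Integrable fun z => F z * fderiv ℝ Q z b := fun b =>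
    (hF.continuous.mul (hQ' b)).integrable_of_hasCompactSupport hFc.mul_right
  have i3 : Integrable fun z => F z * Q z :=
    (hF.continuous.mul hQ.continuous).integrable_of_hasCompactSupport hFc.mul_right
  have key : ∀ b : X → ℂ, ∫ z, F z * fderiv ℝ Q z b = -∫ z, fderiv ℝ F z b * Q z := fun b =>
    integral_mul_fderiv_eq_neg_fderiv_mul_of_integrable (i1 b) (i2 b) i3
      (fun z _ => (hF.differentiable (by simp)) z) (fun z _ => (hQ.differentiable (by simp)) z)
  have e1 : ∀ z, F z * wirtinger Q a z = (1 / 2) * (F z * fderiv ℝ Q z a) -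
      (Complex.I / 2) * (F z * fderiv ℝ Q z (Complex.I • a)) := fun z => by
    rw [wirtinger]; ring
  have e2 : ∀ z, wirtinger F a z * Q z = (1 / 2) * (fderiv ℝ F z a * Q z) -
      (Complex.I / 2) * (fderiv ℝ F z (Complex.I • a) * Q z) := fun z => by
    rw [wirtinger]; ring
  simp only [e1, e2]
  rw [integral_sub ((i2 _).const_mul _) ((i2 _).const_mul _),
    integral_sub ((i1 _).const_mul _) ((i1 _).const_mul _)]
  simp only [integral_const_mul, key]
  ring

theorem contDiff_heatProd (d : (X → ℂ) →L[ℂ] (E → ℂ)) (m : E → ℕ) (τ : E → ℝ) :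
    ContDiff ℝ ∞ (heatProd d m τ) := by
  refine contDiff_prod fun e _ => (contDiff_heatDeriv (m e) (τ e)).comp ?_
  exact ((ContinuousLinearMap.proj (R := ℂ) (φ := fun _ : E => ℂ) e).comp d
    |>.restrictScalars ℝ).contDiff

/-- A product of heat kernels and their holomorphic derivatives is an antiholomorphic polynomial
times a Gaussian, so a holomorphic derivative only sees the Gaussian. -/
theorem wirtinger_heatProd (d : (X → ℂ) →L[ℂ] (E → ℂ)) (m : E → ℕ) (τ : E → ℝ) (a z : X → ℂ) :
    wirtinger (heatProd d m τ) a z =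
      -(∑ e, d a e * (conj (d z e) / (4 * τ e))) * heatProd d m τ z := by
  classical
  have hd : ∀ e, HasFDerivAt (fun z : X → ℂ => d z e)
      (((ContinuousLinearMap.proj (R := ℂ) (φ := fun _ : E => ℂ) e).comp d).restrictScalars ℝ) z :=
    fun e => (((ContinuousLinearMap.proj (R := ℂ) (φ := fun _ : E => ℂ) e).comp
      d).restrictScalars ℝ).hasFDerivAt
  have h := HasFDerivAt.finsetProd (u := Finset.univ)
    fun e _ => (hasFDerivAt_heatDeriv (m e) (τ e) (d z e)).comp z (hd e)
  have h' : HasFDerivAt (heatProd d m τ) _ z := h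
  rw [wirtinger, h'.fderiv]
  simp only [sum_apply, smul_apply,
    ContinuousLinearMap.comp_apply, add_apply, smul_eq_mul,
    ContinuousLinearMap.coe_restrictScalars', ContinuousLinearMap.proj_apply, map_smul,
    Function.comp_apply, ContinuousLinearMap.id_apply,
    ContinuousLinearEquiv.coe_coe, Complex.conjCLE_apply, map_mul, Complex.conj_I]
  rw [Finset.mul_sum, ← Finset.sum_sub_distrib, Finset.sum_div, neg_mul, Finset.sum_mul,
    ← Finset.sum_neg_distrib]
  refine Finset.sum_congr rfl fun e _ => ?_
  rw [heatProd, ← Finset.mul_prod_erase _ _ (Finset.mem_univ e), heatDeriv_succ]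
  linear_combination (∏ i ∈ Finset.univ.erase e, heatDeriv (m i) (τ i) (d z i)) *
    ((conj (d z e) / (4 * τ e) * heatDeriv (m e) (τ e) (d z e)) * d a e / 2 +
      heatConjDeriv (m e) (τ e) (d z e) * conj (d a e) / 2) * Complex.I_sq

end Wirtinger

/-! ### The propagator and its derivative -/

theorem norm_heatConjDeriv_le {t ℓ R : ℝ} (hℓ : 0 < ℓ) (h : ℓ ≤ t) (m : ℕ) {u : ℂ} (hu : ‖u‖ ≤ R) :
    ‖heatConjDeriv m t u‖ ≤
      1 / (4 * Real.pi * ℓ) * (m * (R / (4 * ℓ)) ^ (m - 1) / (4 * ℓ)) +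
        R / (4 * ℓ) * (1 / (4 * Real.pi * ℓ) * (R / (4 * ℓ)) ^ m) := by
  have ht : 0 < t := hℓ.trans_le h
  have hR : 0 ≤ R := (norm_nonneg u).trans hu
  have h1 : Real.exp (-(1 / (4 * t)) * ‖u‖ ^ 2) ≤ 1 := by
    rw [Real.exp_le_one_iff, neg_mul, neg_nonpos]; positivity
  have h2 := norm_heatDeriv_le hℓ h m u
  refine (norm_sub_le _ _).trans (add_le_add ?_ ?_)
  · rw [norm_mul, norm_exp_heat]
    simp only [norm_mul, norm_div, norm_pow, norm_one, RCLike.norm_conj, Complex.norm_real,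
      Complex.norm_natCast, Complex.norm_ofNat, Real.norm_eq_abs, abs_of_pos ht,
      abs_of_pos Real.pi_pos]
    calc _ ≤ 1 / (4 * Real.pi * t) * (m * (‖u‖ / (4 * t)) ^ (m - 1) / (4 * t)) * 1 := by gcongr
      _ ≤ _ := by rw [mul_one]; gcongr
  · simp only [norm_mul, norm_div, Complex.norm_real, Complex.norm_ofNat, Real.norm_eq_abs,
      abs_of_pos ht]
    gcongr
    exact h2.trans (by gcongr)

theorem integrableOn_heatDeriv {ℓ : ℝ} (hℓ : 0 < ℓ) (L : ℝ) (m : ℕ) (u : ℂ) :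
    IntegrableOn (fun t => heatDeriv m t u) (Ioc ℓ L) :=
  Measure.integrableOn_of_bounded (M := 1 / (4 * Real.pi * ℓ) * (‖u‖ / (4 * ℓ)) ^ m)
    (by simp) (measurable_heatDeriv m measurable_id measurable_const).aestronglyMeasurable
    ((ae_restrict_iff' measurableSet_Ioc).2 (ae_of_all _ fun t ht =>
      norm_heatDeriv_le hℓ ht.1.le m u))

/-- The time integral of `heatDeriv` can be differentiated under the integral sign. -/
theorem hasFDerivAt_integral_heatDeriv {ℓ L : ℝ} (hℓ : 0 < ℓ) (m : ℕ) (u : ℂ) :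
    HasFDerivAt (fun u => ∫ t in Ioc ℓ L, heatDeriv m t u)
      (∫ t in Ioc ℓ L, ((-heatDeriv (m + 1) t u) • ContinuousLinearMap.id ℝ ℂ +
        heatConjDeriv m t u • (Complex.conjCLE : ℂ →L[ℝ] ℂ))) u := by
  set R := ‖u‖ + 1
  have hm : Measurable fun t => heatConjDeriv m t u := by
    unfold heatConjDeriv
    fun_prop
  refine hasFDerivAt_integral_of_dominated_of_fderiv_le (s := Metric.ball u 1)
    (bound := fun _ => 1 / (4 * Real.pi * ℓ) * (R / (4 * ℓ)) ^ (m + 1) * 1 +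
      (1 / (4 * Real.pi * ℓ) * (m * (R / (4 * ℓ)) ^ (m - 1) / (4 * ℓ)) +
        R / (4 * ℓ) * (1 / (4 * Real.pi * ℓ) * (R / (4 * ℓ)) ^ m)) * 1)
    (F' := fun u t => (-heatDeriv (m + 1) t u) • ContinuousLinearMap.id ℝ ℂ +
        heatConjDeriv m t u • (Complex.conjCLE : ℂ →L[ℝ] ℂ))
    (Metric.ball_mem_nhds u one_pos)
    (Eventually.of_forall fun x =>
      (measurable_heatDeriv m measurable_id measurable_const).aestronglyMeasurable)
    (integrableOn_heatDeriv hℓ L m u) ?_ ?_ (by simp) ?_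
  · have h1 := measurable_heatDeriv (m + 1) measurable_id (measurable_const (a := u))
    exact (h1.neg.aestronglyMeasurable.smul_const _).add
      (hm.aestronglyMeasurable.smul_const _)
  · refine (ae_restrict_iff' measurableSet_Ioc).2 (ae_of_all _ fun t ht x hx => ?_)
    have hx' : ‖x‖ ≤ R := by
      have h1 : ‖x - u‖ < 1 := by simpa [dist_eq_norm] using hx
      have h2 := norm_add_le (x - u) u
      rw [sub_add_cancel] at h2
      simp only [R]; linarith
    refine (norm_add_le _ _).trans (add_le_add ?_ ?_)
    · rw [norm_smul, norm_neg]
      refine mul_le_mul ((norm_heatDeriv_le hℓ ht.1.le (m + 1) x).trans ?_)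
        ContinuousLinearMap.norm_id_le (norm_nonneg _) (by positivity)
      gcongr
    · rw [norm_smul]
      exact mul_le_mul (norm_heatConjDeriv_le hℓ ht.1.le m hx')
        (Complex.conjLIE.toLinearIsometry.norm_toContinuousLinearMap_le)
        (norm_nonneg _) (by positivity)
  · exact ae_of_all _ fun t x _ => hasFDerivAt_heatDeriv m t x

theorem propagator_eq {ℓ L : ℝ} (hL : ℓ ≤ L) (z w : ℂ) :
    propagator ℓ L z w = 2 * ∫ t in Ioc ℓ L, heatDeriv 1 t (z - w) := by
  rw [propagator, intervalIntegral.integral_of_le hL, ← integral_const_mul]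
  congr 1
  ext t
  rw [dz_heatKernel, heatDeriv, ← map_sub, ← Complex.mul_conj']
  ring

theorem dz_propagator {ℓ L : ℝ} (hℓ : 0 < ℓ) (hL : ℓ ≤ L) (z w : ℂ) :
    dz (propagator ℓ L z) w = 2 * ∫ t in Ioc ℓ L, heatDeriv 2 t (z - w) := by
  have hm : Measurable fun t => heatConjDeriv 1 t (z - w) := by
    unfold heatConjDeriv
    fun_prop
  have h := hasFDerivAt_integral_heatDeriv (L := L) hℓ 1 (z - w)
  have i2 : IntegrableOn (fun t => heatConjDeriv 1 t (z - w)) (Ioc ℓ L) :=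
    Measure.integrableOn_of_bounded (by simp) hm.aestronglyMeasurable
      ((ae_restrict_iff' measurableSet_Ioc).2 (ae_of_all _ fun t ht =>
        norm_heatConjDeriv_le hℓ ht.1.le 1 le_rfl))
  have i1 : Integrable (fun t => (-heatDeriv (1 + 1) t (z - w)) • ContinuousLinearMap.id ℝ ℂ)
      (volume.restrict (Ioc ℓ L)) := (integrableOn_heatDeriv hℓ L 2 (z - w)).neg.smul_const _
  rw [integral_add i1 (i2.smul_const _), integral_smul_const, integral_smul_const,
    integral_neg] at h
  have h' := (h.comp w ((hasFDerivAt_id (𝕜 := ℝ) w).const_sub z)).const_mul 2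
  have h'' : HasFDerivAt (propagator ℓ L z) _ w :=
    h'.congr_of_eventuallyEq (Eventually.of_forall fun w => propagator_eq hL z w)
  rw [dz, h''.fderiv]
  simp
  ring_nf
  rw [Complex.I_sq]
  ring

/-! ### Convergence of regularised graph integrals -/

section Convergence

variable {X E : Type*} [Fintype E]

theorem prod_integral_heatDeriv (d : (X → ℂ) →L[ℂ] (E → ℂ)) (m : E → ℕ) (ℓ L : ℝ) (z : X → ℂ) :
    ∏ e, ∫ t in Ioc ℓ L, heatDeriv (m e) t (d z e) =
      ∫ τ in univ.pi fun _ : E => Ioc ℓ L, heatProd d m τ z := by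
  rw [volume_pi, Measure.restrict_pi_pi]
  exact (integral_fintype_prod_eq_prod (𝕜 := ℂ) fun e t => heatDeriv (m e) t (d z e)).symm

variable [Fintype X]

/-- The Gaussian `exp (-∑ e, |d z e| ^ 2 / (4 * τ e))` can be multiplied by each of the factors
`conj (d z e) / (4 * τ e)` by applying a holomorphic vector field with constant coefficients, and
these coefficients are bounded uniformly in the times `τ`. -/
def HasBoundedLifts (d : (X → ℂ) →L[ℂ] (E → ℂ)) : Prop :=
  ∃ C : ℝ, ∀ τ : E → ℝ, (∀ e, 0 < τ e) → ∀ e, ∃ a : X → ℂ, (∀ v, ‖a v‖ ≤ C) ∧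
    ∀ z, ∑ e', d a e' * (conj (d z e') / (4 * τ e')) = conj (d z e) / (4 * τ e)

/-- The integral over the positions of a test function times the heat kernels at times `τ`,
without derivatives, is at most a constant, which depends on the test function, times `B τ` for
times in `(0, L]`. -/
def HasHeatBound (d : (X → ℂ) →L[ℂ] (E → ℂ)) (L : ℝ) (B : (E → ℝ) → ℝ) : Prop :=
  ∀ F : (X → ℂ) → ℂ, ContDiff ℝ ∞ F → HasCompactSupport F → ∃ C : ℝ, ∀ τ : E → ℝ,
    (∀ e, τ e ∈ Ioc 0 L) → ‖∫ z, F z * heatProd d 0 τ z‖ ≤ C * B τ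

/-- Derivatives on the heat kernels do not worsen the bound: they are moved to the test function
one at a time. -/
theorem HasHeatBound.heatProd {d : (X → ℂ) →L[ℂ] (E → ℂ)} {L : ℝ} {B : (E → ℝ) → ℝ}
    (hB : HasHeatBound d L B) (hd : HasBoundedLifts d) (m : E → ℕ)
    {F : (X → ℂ) → ℂ} (hF : ContDiff ℝ ∞ F) (hFc : HasCompactSupport F) :
    ∃ C : ℝ, ∀ τ : E → ℝ, (∀ e, τ e ∈ Ioc 0 L) →
      ‖∫ z, F z * heatProd d m τ z‖ ≤ C * B τ := by
  classical
  obtain ⟨A, hA⟩ := hd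
  induction hN : ∑ e, m e generalizing m F with
  | zero =>
    have : m = 0 := by
      ext e
      simpa using (Finset.sum_eq_zero_iff.1 hN) e (Finset.mem_univ e)
    subst this
    exact hB F hF hFc
  | succ N ih =>
    obtain ⟨e, he⟩ : ∃ e, m e ≠ 0 := by
      by_contra! h
      simp [h] at hN
    obtain ⟨m', rfl⟩ : ∃ m' : E → ℕ, m = m' + (Pi.single e 1 : E → ℕ) := by
      refine ⟨fun e' => m e' - (Pi.single e 1 : E → ℕ) e', ?_⟩
      refine funext fun e' => ?_
      rw [Pi.add_apply]
      by_cases h : e' = e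
      · rw [h, Pi.single_eq_same]; omega
      · rw [Pi.single_eq_of_ne h]; omega
    have hN' : ∑ e, m' e = N := by
      simp only [Pi.add_apply, Finset.sum_add_distrib, Finset.sum_pi_single', Finset.mem_univ,
        if_true] at hN
      omega
    choose C hC using fun v => ih m' (contDiff_wirtinger hF (Pi.single v 1))
      (hasCompactSupport_wirtinger hFc (Pi.single v 1)) hN'
    refine ⟨∑ v, A * C v, fun τ hτ => ?_⟩
    -- One factor at the edge `e` is produced by the derivative along `a`, which depends on `τ`;
    -- only its coefficients do, so the constants `C v` of the derivatives of `F` are uniform.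
    obtain ⟨a, haA, ha⟩ := hA τ (fun e => (hτ e).1) e
    have h1 : ∀ z, F z * HolomorphicString.heatProd d (m' + (Pi.single e 1 : E → ℕ)) τ z =
        -(F z * wirtinger (HolomorphicString.heatProd d m' τ) a z) := fun z => by
      rw [heatProd_add_single, wirtinger_heatProd, ha]; ring
    have h2 : ∀ v, Integrable fun z => a v *
        (wirtinger F (Pi.single v 1) z * HolomorphicString.heatProd d m' τ z) := fun v =>
      (((contDiff_wirtinger hF _).continuous.mul
        (contDiff_heatProd d m' τ).continuous).integrable_of_hasCompactSupport
          (hasCompactSupport_wirtinger hFc _).mul_right).const_mul _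
    have h3 : ∀ z, wirtinger F a z * HolomorphicString.heatProd d m' τ z = ∑ v, a v *
        (wirtinger F (Pi.single v 1) z * HolomorphicString.heatProd d m' τ z) := fun z => by
      rw [wirtinger_eq_sum, Finset.sum_mul]
      simp only [mul_assoc]
    simp only [h1]
    rw [integral_neg, integral_mul_wirtinger hF hFc (contDiff_heatProd d m' τ), neg_neg]
    simp only [h3]
    rw [integral_finsetSum _ fun v _ => h2 v, Finset.sum_mul]
    refine (norm_sum_le _ _).trans (Finset.sum_le_sum fun v _ => ?_)
    rw [integral_const_mul, norm_mul, mul_assoc]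
    have := hC v τ hτ
    have := haA v
    gcongr
    exact (norm_nonneg _).trans this

/-- A family of regularised integrands has absolutely convergent integrals, which converge as the
cutoff `ℓ` tends to zero. -/
def IsRegular (L : ℝ) (f : ℝ → (X → ℂ) → ℂ) : Prop :=
  (∀ ℓ, 0 < ℓ → ℓ < L → Integrable (f ℓ)) ∧
    ∃ w : ℂ, Tendsto (fun ℓ => ∫ z, f ℓ z) (𝓝[>] 0) (𝓝 w)

theorem IsRegular.const_mul {L : ℝ} {f : ℝ → (X → ℂ) → ℂ} (hf : IsRegular L f) (c : ℂ) :
    IsRegular L fun ℓ z => c * f ℓ z := by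
  obtain ⟨h, w, hw⟩ := hf
  refine ⟨fun ℓ h0 h1 => (h ℓ h0 h1).const_mul c, c * w, ?_⟩
  simpa only [integral_const_mul] using hw.const_mul c

theorem IsRegular.congr {L : ℝ} (hL : 0 < L) {f g : ℝ → (X → ℂ) → ℂ} (hf : IsRegular L f)
    (h : ∀ ℓ, 0 < ℓ → ℓ < L → g ℓ = f ℓ) : IsRegular L g := by
  obtain ⟨hi, w, hw⟩ := hf
  refine ⟨fun ℓ h0 h1 => h ℓ h0 h1 ▸ hi ℓ h0 h1, w, hw.congr' ?_⟩
  filter_upwards [Ioo_mem_nhdsGT hL] with ℓ hℓ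
  rw [h ℓ hℓ.1 hℓ.2]

theorem isRegular_zero (L : ℝ) : IsRegular L (fun _ (_ : X → ℂ) => 0) :=
  ⟨fun _ _ _ => integrable_zero _ _ _, 0, by simp⟩

theorem IsRegular.sum {L : ℝ} (hL : 0 < L) {κ : Type*} (s : Finset κ)
    {f : κ → ℝ → (X → ℂ) → ℂ} (hf : ∀ k ∈ s, IsRegular L (f k)) :
    IsRegular L fun ℓ z => ∑ k ∈ s, f k ℓ z := by
  choose! w hw using fun k hk => (hf k hk).2
  refine ⟨fun ℓ h0 h1 => integrable_finsetSum _ fun k hk => (hf k hk).1 ℓ h0 h1,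
    ∑ k ∈ s, w k, (tendsto_finsetSum _ fun k hk => hw k hk).congr' ?_⟩
  filter_upwards [Ioo_mem_nhdsGT hL] with ℓ hℓ
  rw [integral_finsetSum _ fun k hk => (hf k hk).1 ℓ hℓ.1 hℓ.2]

theorem measurable_heatProd (d : (X → ℂ) →L[ℂ] (E → ℂ)) (m : E → ℕ) :
    Measurable fun p : (E → ℝ) × (X → ℂ) => heatProd d m p.1 p.2 := by
  have hd : ∀ e, Measurable fun p : (E → ℝ) × (X → ℂ) => d p.2 e := fun e =>
    (measurable_pi_apply e).comp (d.continuous.measurable.comp measurable_snd)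
  have ht : ∀ e, Measurable fun p : (E → ℝ) × (X → ℂ) => p.1 e := fun e =>
    (measurable_pi_apply e).comp measurable_fst
  exact Finset.measurable_fun_prod _ fun e _ => measurable_heatDeriv (m e) (ht e) (hd e)

/-- Away from time zero the integrand is integrable jointly in times and positions. -/
theorem integrable_mul_heatProd (d : (X → ℂ) →L[ℂ] (E → ℂ)) (m : E → ℕ) {ℓ : ℝ} (hℓ : 0 < ℓ)
    (L : ℝ) {F : (X → ℂ) → ℂ} (hF : Continuous F) (hFc : HasCompactSupport F) :
    Integrable (fun p : (E → ℝ) × (X → ℂ) => F p.2 * heatProd d m p.1 p.2)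
      ((volume.restrict (univ.pi fun _ : E => Ioc ℓ L)).prod volume) := by
  have hfin : IsFiniteMeasure
      ((volume : Measure (E → ℝ)).restrict (univ.pi fun _ : E => Ioc ℓ L)) := by
    rw [volume_pi, Measure.restrict_pi_pi]; infer_instance
  let g : (X → ℂ) → ℝ := fun z =>
    ‖F z‖ * ∏ e, (1 / (4 * Real.pi * ℓ) * (‖d z e‖ / (4 * ℓ)) ^ m e)
  have hg : Integrable g := by
    refine Continuous.integrable_of_hasCompactSupport ?_ hFc.norm.mul_right
    have : ∀ e, Continuous fun z => d z e := fun e => (continuous_apply e).comp d.continuous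
    fun_prop
  refine (hg.comp_snd (volume.restrict (univ.pi fun _ : E => Ioc ℓ L))).mono'
    ((hF.measurable.comp measurable_snd).mul (measurable_heatProd d m)).aestronglyMeasurable ?_
  have hae : ∀ᵐ p ∂((volume.restrict (univ.pi fun _ : E => Ioc ℓ L)).prod
      (volume : Measure (X → ℂ))), p.1 ∈ univ.pi fun _ : E => Ioc ℓ L :=
    Measure.quasiMeasurePreserving_fst.ae
      (ae_restrict_mem (MeasurableSet.univ_pi fun _ => measurableSet_Ioc))
  filter_upwards [hae] with p hp
  rw [norm_mul, heatProd, norm_prod]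
  exact mul_le_mul_of_nonneg_left (Finset.prod_le_prod (fun _ _ => norm_nonneg _) fun e _ =>
    norm_heatDeriv_le hℓ (hp e trivial).1.le _ _) (norm_nonneg _)

/-- A family of boxes exhausting the times `(0, L]`. -/
theorem aecover_Ioc (L : ℝ) :
    AECover (volume.restrict (univ.pi fun _ : E => Ioc (0 : ℝ) L)) (𝓝[>] (0 : ℝ))
      fun ℓ => univ.pi fun _ : E => Ioc ℓ L where
  ae_eventually_mem := by
    filter_upwards [ae_restrict_mem (MeasurableSet.univ_pi fun _ => measurableSet_Ioc)] with τ hτ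
    have : ∀ᶠ ℓ in 𝓝[>] (0 : ℝ), ∀ e, ℓ < τ e :=
      eventually_all.2 fun e => by
        filter_upwards [Ioo_mem_nhdsGT (hτ e trivial).1] with ℓ h using h.2
    filter_upwards [this] with ℓ h e _
    exact ⟨h e, (hτ e trivial).2⟩
  measurableSet _ := MeasurableSet.univ_pi fun _ => measurableSet_Ioc

/-- By Fubini the regularised integral is an integral over the times of a function which is
dominated by an integrable one. -/
theorem isRegular_of_hasHeatBound {d : (X → ℂ) →L[ℂ] (E → ℂ)} {L : ℝ} {B : (E → ℝ) → ℝ}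
    (hB : HasHeatBound d L B) (hd : HasBoundedLifts d)
    (hBi : IntegrableOn B (univ.pi fun _ => Ioc 0 L)) (m : E → ℕ)
    {F : (X → ℂ) → ℂ} (hF : ContDiff ℝ ∞ F) (hFc : HasCompactSupport F) :
    IsRegular L fun ℓ z => F z * ∏ e, ∫ t in Ioc ℓ L, heatDeriv (m e) t (d z e) := by
  obtain ⟨C, hC⟩ := hB.heatProd hd m hF hFc
  have hrw : ∀ ℓ z, F z * ∏ e, ∫ t in Ioc ℓ L, heatDeriv (m e) t (d z e) =
      ∫ τ in univ.pi fun _ : E => Ioc ℓ L, F z * heatProd d m τ z := fun ℓ z => by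
    rw [prod_integral_heatDeriv, integral_const_mul]
  have hG : IntegrableOn (fun τ => ∫ z, F z * heatProd d m τ z)
      (univ.pi fun _ : E => Ioc 0 L) := by
    refine (hBi.const_mul C).mono' ?_ ?_
    · have : StronglyMeasurable fun p : (E → ℝ) × (X → ℂ) => F p.2 * heatProd d m p.1 p.2 :=
        ((hF.continuous.measurable.comp measurable_snd).mul
          (measurable_heatProd d m)).stronglyMeasurable
      exact this.integral_prod_right'.aestronglyMeasurable
    · filter_upwards [ae_restrict_mem (MeasurableSet.univ_pi fun _ => measurableSet_Ioc)] with τ hτ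
      exact hC τ fun e => hτ e trivial
  simp only [hrw]
  refine ⟨fun ℓ hℓ _ =>
      (integrable_mul_heatProd d m hℓ L hF.continuous hFc).integral_prod_right,
    ∫ τ in univ.pi fun _ : E => Ioc 0 L, ∫ z, F z * heatProd d m τ z, ?_⟩
  refine ((aecover_Ioc L).integral_tendsto_of_countably_generated hG).congr' ?_
  filter_upwards [self_mem_nhdsWithin] with ℓ hℓ
  rw [Measure.restrict_restrict (MeasurableSet.univ_pi fun _ => measurableSet_Ioc),
    inter_eq_self_of_subset_left
      (Set.pi_mono fun _ _ => Ioc_subset_Ioc_left (le_of_lt (mem_Ioi.1 hℓ)))]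
  exact integral_integral_swap (integrable_mul_heatProd d m hℓ L hF.continuous hFc)

end Convergence

/-! ### Trees -/

section Tree

variable {X E : Type*} [Fintype X] [Fintype E]

theorem integral_norm_heatDeriv_zero {t : ℝ} (ht : 0 < t) : ∫ u, ‖heatDeriv 0 t u‖ = 1 := by
  simp only [norm_heatDeriv ht, pow_zero, mul_one]
  rw [integral_const_mul, GaussianFourier.integral_rexp_neg_mul_sq_norm (by positivity),
    Complex.finrank_real_complex]
  have := Real.pi_pos
  norm_num
  field_simp

theorem integrable_norm_heatDeriv_zero {t : ℝ} (ht : 0 < t) :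
    Integrable fun u => ‖heatDeriv 0 t u‖ :=
  not_imp_comm.1 integral_undef (by rw [integral_norm_heatDeriv_zero ht]; exact one_ne_zero)

/-- If the edge differences determine the positions up to translation and there is one edge less
than there are vertices, then the position of one vertex and the edge differences are linear
coordinates on the space of positions. -/
theorem exists_treeCoordinates {d : (X → ℂ) →L[ℂ] (E → ℂ)} (r : X)
    (hker : ∀ z, d z = 0 → z r = 0 → z = 0) (hcard : Fintype.card E + 1 = Fintype.card X) :
    ∃ A : (X → ℂ) ≃L[ℂ] ℂ × (E → ℂ), ∀ z, A z = (z r, d z) := by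
  let f : (X → ℂ) →ₗ[ℂ] ℂ × (E → ℂ) := (LinearMap.proj r).prod d.toLinearMap
  have hf : Function.Injective f := by
    refine (injective_iff_map_eq_zero f).2 fun z hz => ?_
    have hz' : (z r, d z) = 0 := hz
    rw [Prod.mk_eq_zero] at hz'
    exact hker z hz'.2 hz'.1
  have hdim : Module.finrank ℂ (X → ℂ) = Module.finrank ℂ (ℂ × (E → ℂ)) := by
    simp [← hcard, add_comm]
  exact ⟨(f.linearEquivOfInjective hf hdim).toContinuousLinearEquiv, fun z => rfl⟩

theorem surjective_of_tree {d : (X → ℂ) →L[ℂ] (E → ℂ)} (r : X)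
    (hker : ∀ z, d z = 0 → z r = 0 → z = 0) (hcard : Fintype.card E + 1 = Fintype.card X)
    (y : E → ℂ) : ∃ a, d a = y := by
  obtain ⟨A, hA⟩ := exists_treeCoordinates r hker hcard
  refine ⟨A.symm (0, y), ?_⟩
  have := hA (A.symm (0, y))
  rw [A.apply_symm_apply] at this
  exact (congrArg Prod.snd this).symm

theorem hasBoundedLifts_of_tree {d : (X → ℂ) →L[ℂ] (E → ℂ)} (r : X)
    (hker : ∀ z, d z = 0 → z r = 0 → z = 0) (hcard : Fintype.card E + 1 = Fintype.card X) :
    HasBoundedLifts d := by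
  classical
  choose a ha using fun e => surjective_of_tree r hker hcard (Pi.single e 1)
  refine ⟨∑ e, ∑ v, ‖a e v‖, fun τ _ e => ⟨a e, fun v => ?_, fun z => ?_⟩⟩
  · calc ‖a e v‖ ≤ ∑ v, ‖a e v‖ :=
        Finset.single_le_sum (f := fun v => ‖a e v‖) (fun _ _ => norm_nonneg _) (Finset.mem_univ v)
      _ ≤ _ := Finset.single_le_sum (f := fun e => ∑ v, ‖a e v‖)
        (fun _ _ => Finset.sum_nonneg fun _ _ => norm_nonneg _) (Finset.mem_univ e)
  · simp [ha, Pi.single_apply]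

/-- In tree coordinates the heat kernels separate, and each of them has total mass one. -/
theorem exists_bound_integral_tree {d : (X → ℂ) →L[ℂ] (E → ℂ)} (r : X)
    (hker : ∀ z, d z = 0 → z r = 0 → z = 0) (hcard : Fintype.card E + 1 = Fintype.card X)
    {F : (X → ℂ) → ℂ} (hF : Continuous F) (hFc : HasCompactSupport F) :
    ∃ C : ℝ, ∀ τ : E → ℝ, (∀ e, 0 < τ e) →
      ∫ z, ‖F z‖ * ∏ e, ‖heatDeriv 0 (τ e) (d z e)‖ ≤ C := by
  obtain ⟨A, hA⟩ := exists_treeCoordinates r hker hcard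
  obtain ⟨M, hM⟩ := hF.bounded_above_of_compact_support hFc
  obtain ⟨R, hR⟩ := hFc.isCompact.isBounded.subset_closedBall 0
  let A' : (X → ℂ) ≃ₜ ℂ × (E → ℂ) := A.toHomeomorph
  have hAm : Measurable A := A'.measurable
  have hmap : (Measure.map A (volume : Measure (X → ℂ))).IsAddHaarMeasure :=
    A.isAddHaarMeasure_map volume
  have hprod : ((volume : Measure ℂ).prod (volume : Measure (E → ℂ))).IsAddHaarMeasure :=
    Measure.prod.instIsAddHaarMeasure _ _
  obtain ⟨c, hc⟩ : ∃ c : NNReal, Measure.map A (volume : Measure (X → ℂ)) =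
      c • ((volume : Measure ℂ).prod (volume : Measure (E → ℂ))) :=
    ⟨_, Measure.isAddLeftInvariant_eq_smul _ _⟩
  -- `F` is bounded by `M` and vanishes unless the position of `r` is in a ball.
  let φ : ℂ → ℝ := (Metric.closedBall (0 : ℂ) R).indicator fun _ => M
  have hφ : Integrable φ :=
    (integrable_indicator_iff measurableSet_closedBall).2
      (integrableOn_const (measure_closedBall_lt_top).ne)
  refine ⟨c * (∫ w, φ w), fun τ hτ => ?_⟩
  let g : ℂ × (E → ℂ) → ℝ := fun p => φ p.1 * ∏ e, ‖heatDeriv 0 (τ e) (p.2 e)‖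
  have hg : Integrable g ((volume : Measure ℂ).prod (volume : Measure (E → ℂ))) :=
    hφ.mul_prod (Integrable.fintype_prod fun e => integrable_norm_heatDeriv_zero (hτ e))
  have hgm : Integrable g (Measure.map A (volume : Measure (X → ℂ))) := by
    rw [hc]; exact hg.smul_measure_nnreal
  have hint : ∫ p, g p ∂((volume : Measure ℂ).prod (volume : Measure (E → ℂ))) = ∫ w, φ w := by
    rw [integral_prod_mul φ fun y : E → ℂ => ∏ e, ‖heatDeriv 0 (τ e) (y e)‖,
      integral_fintype_prod_volume_eq_prod fun e u => ‖heatDeriv 0 (τ e) u‖]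
    simp [integral_norm_heatDeriv_zero (hτ _)]
  calc ∫ z, ‖F z‖ * ∏ e, ‖heatDeriv 0 (τ e) (d z e)‖ ≤ ∫ z, g (A z) := by
        refine integral_mono_of_nonneg (ae_of_all _ fun z => by positivity)
          (hgm.comp_measurable hAm) (ae_of_all _ fun z => ?_)
        simp only [g, hA]
        refine mul_le_mul_of_nonneg_right ?_ (Finset.prod_nonneg fun _ _ => norm_nonneg _)
        by_cases hz : F z = 0
        · rw [hz, norm_zero]
          exact indicator_nonneg (fun _ _ => (norm_nonneg _).trans (hM 0)) _
        · have hzR : ‖z‖ ≤ R := by simpa using hR (subset_tsupport _ hz)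
          have : z r ∈ Metric.closedBall (0 : ℂ) R := by
            simpa using (norm_le_pi_norm z r).trans hzR
          simp only [φ, indicator_of_mem this]
          exact hM z
    _ = ∫ p, g p ∂(Measure.map A (volume : Measure (X → ℂ))) :=
        (integral_map_equiv A'.toMeasurableEquiv g).symm
    _ = c * ∫ w, φ w := by
        rw [hc, integral_smul_nnreal_measure, hint]; rfl

theorem hasHeatBound_of_tree {d : (X → ℂ) →L[ℂ] (E → ℂ)} (r : X)
    (hker : ∀ z, d z = 0 → z r = 0 → z = 0) (hcard : Fintype.card E + 1 = Fintype.card X)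
    (L : ℝ) : HasHeatBound d L fun _ => 1 := by
  intro F hF hFc
  obtain ⟨C, hC⟩ := exists_bound_integral_tree r hker hcard hF.continuous hFc
  refine ⟨C, fun τ hτ => ?_⟩
  rw [mul_one]
  refine le_trans (norm_integral_le_integral_norm _) ?_
  simp only [norm_mul, heatProd, norm_prod]
  exact hC τ fun e => (hτ e).1

theorem isRegular_of_tree {d : (X → ℂ) →L[ℂ] (E → ℂ)} (r : X)
    (hker : ∀ z, d z = 0 → z r = 0 → z = 0) (hcard : Fintype.card E + 1 = Fintype.card X)
    (L : ℝ) (m : E → ℕ) {F : (X → ℂ) → ℂ} (hF : ContDiff ℝ ∞ F) (hFc : HasCompactSupport F) :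
    IsRegular L fun ℓ z => F z * ∏ e, ∫ t in Ioc ℓ L, heatDeriv (m e) t (d z e) := by
  refine isRegular_of_hasHeatBound (hasHeatBound_of_tree r hker hcard L)
    (hasBoundedLifts_of_tree r hker hcard) ?_ m hF hFc
  rw [IntegrableOn, volume_pi, Measure.restrict_pi_pi]
  exact integrable_const 1

end Tree

/-! ### Wheels -/

section Wheel

variable {X E : Type*} [Fintype E]

/-- The edge differences of the graph without the edge `e₀`. -/
noncomputable def deleteEdge (d : (X → ℂ) →L[ℂ] (E → ℂ)) (e₀ : E) :
    (X → ℂ) →L[ℂ] ({e : E // e ≠ e₀} → ℂ) :=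
  ContinuousLinearMap.pi fun e => (ContinuousLinearMap.proj e.1).comp d

theorem deleteEdge_ker {d : (X → ℂ) →L[ℂ] (E → ℂ)} (hsum : ∀ z, ∑ e, d z e = 0) (e₀ : E)
    {z : X → ℂ} (hz : deleteEdge d e₀ z = 0) : d z = 0 := by
  classical
  have h : ∀ e, e ≠ e₀ → d z e = 0 := fun e he => congrFun hz ⟨e, he⟩
  have h0 : d z e₀ = 0 := by
    rw [← hsum z]
    exact (Finset.sum_eq_single e₀ (fun e _ he => h e he) (by simp)).symm
  ext e
  by_cases he : e = e₀
  · rw [he, h0]; rfl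
  · exact h e he

variable [Fintype X]

theorem card_deleteEdge [DecidableEq E] (hcard : Fintype.card E = Fintype.card X) (e₀ : E) :
    Fintype.card {e : E // e ≠ e₀} + 1 = Fintype.card X := by
  have := Fintype.card_pos_iff.2 ⟨e₀⟩
  rw [← hcard, Fintype.card_subtype_compl, Fintype.card_subtype_eq]
  omega

theorem exists_apply_eq_of_wheel {d : (X → ℂ) →L[ℂ] (E → ℂ)} (r : X)
    (hker : ∀ z, d z = 0 → z r = 0 → z = 0) (hsum : ∀ z, ∑ e, d z e = 0)
    (hcard : Fintype.card E = Fintype.card X) (e₀ : E) {y : E → ℂ} (hy : ∑ e, y e = 0) :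
    ∃ a, d a = y := by
  classical
  obtain ⟨a, ha⟩ := surjective_of_tree (d := deleteEdge d e₀) r
    (fun z hz => hker z (deleteEdge_ker hsum e₀ hz)) (card_deleteEdge hcard e₀) fun e => y e.1
  have h : ∀ e, e ≠ e₀ → d a e - y e = 0 := fun e he => sub_eq_zero.2 (congrFun ha ⟨e, he⟩)
  have h0 : d a e₀ - y e₀ = 0 := by
    have : ∑ e, (d a e - y e) = 0 := by rw [Finset.sum_sub_distrib, hsum, hy, sub_zero]
    rw [← this]
    exact (Finset.sum_eq_single e₀ (fun e _ he => h e he) (by simp)).symm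
  refine ⟨a, funext fun e => ?_⟩
  by_cases he : e = e₀
  · rw [he]; exact sub_eq_zero.1 h0
  · exact sub_eq_zero.1 (h e he)

/-- In a wheel the differences along the edges add up to zero, so `conj (d z e) / (4 * τ e)` is
obtained from a vector field whose edge differences are those of `e` minus the probability weights
`τ e' / ∑ τ`. -/
theorem hasBoundedLifts_of_wheel {d : (X → ℂ) →L[ℂ] (E → ℂ)} (r : X)
    (hker : ∀ z, d z = 0 → z r = 0 → z = 0) (hsum : ∀ z, ∑ e, d z e = 0)
    (hcard : Fintype.card E = Fintype.card X) : HasBoundedLifts d := by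
  classical
  have : Nonempty E := Fintype.card_pos_iff.1 (hcard ▸ Fintype.card_pos_iff.2 ⟨r⟩)
  let e₀ : E := Classical.arbitrary E
  -- Edge differences have sum zero, so only `δ_e - δ_e₀` can be prescribed; the reference edge `e₀`
  -- drops out of the weighted combination below because the weights add up to one.
  choose a ha using fun e => exists_apply_eq_of_wheel (d := d) r hker hsum hcard e₀
    (y := Pi.single e 1 - Pi.single e₀ 1) (by simp [Finset.sum_sub_distrib])
  let C : ℝ := ∑ e, ∑ v, ‖a e v‖
  have hC : ∀ v, ∑ e, ‖a e v‖ ≤ C := fun v => Finset.sum_le_sum fun e _ =>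
    Finset.single_le_sum (f := fun v => ‖a e v‖) (fun _ _ => norm_nonneg _) (Finset.mem_univ v)
  refine ⟨C + C, fun τ hτ e => ?_⟩
  let T : ℝ := ∑ e, τ e
  have hT : 0 < T := Finset.sum_pos (fun e _ => hτ e) Finset.univ_nonempty
  have hT1 : ∑ i, ((τ i / T : ℝ) : ℂ) = 1 := by
    rw [← Complex.ofReal_sum, ← Finset.sum_div, div_self hT.ne', Complex.ofReal_one]
  refine ⟨a e - ∑ i, ((τ i / T : ℝ) : ℂ) • a i, fun v => ?_, fun z => ?_⟩
  · rw [Pi.sub_apply, Finset.sum_apply]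
    refine (norm_sub_le _ _).trans (add_le_add ?_ ?_)
    · exact (Finset.single_le_sum (f := fun e => ‖a e v‖) (fun _ _ => norm_nonneg _)
        (Finset.mem_univ e)).trans (hC v)
    · refine (norm_sum_le _ _).trans (le_trans (Finset.sum_le_sum fun i _ => ?_) (hC v))
      rw [Pi.smul_apply, norm_smul, Complex.norm_real, Real.norm_eq_abs,
        abs_of_pos (div_pos (hτ i) hT)]
      refine mul_le_of_le_one_left (norm_nonneg _) ((div_le_one hT).2 ?_)
      exact Finset.single_le_sum (f := τ) (fun j _ => (hτ j).le) (Finset.mem_univ i)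
  · have hd : ∀ e', d (a e - ∑ i, ((τ i / T : ℝ) : ℂ) • a i) e' =
        (Pi.single e 1 : E → ℂ) e' - τ e' / T := fun e' => by
      have h2 : ∑ i, ((τ i / T : ℝ) : ℂ) * (Pi.single i 1 : E → ℂ) e' = τ e' / T := by
        simp [Pi.single_apply]
      simp only [map_sub, map_sum, map_smul, ha, Pi.sub_apply, Finset.sum_apply, Pi.smul_apply,
        smul_eq_mul, mul_sub, Finset.sum_sub_distrib, ← Finset.sum_mul, hT1, h2]
      ring
    have h3 : ∀ e', (τ e' / T : ℂ) * (conj (d z e') / (4 * τ e')) =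
        conj (d z e') / (4 * T) := fun e' => by
      have h4 : (τ e' : ℂ) ≠ 0 := Complex.ofReal_ne_zero.2 (hτ e').ne'
      have h5 : (T : ℂ) ≠ 0 := Complex.ofReal_ne_zero.2 hT.ne'
      field_simp
    simp only [hd, sub_mul, Finset.sum_sub_distrib, h3]
    rw [← Finset.sum_div, ← map_sum, hsum]
    simp [Pi.single_apply]

theorem norm_heatDeriv_zero_le {t : ℝ} (ht : 0 < t) (u : ℂ) :
    ‖heatDeriv 0 t u‖ ≤ 1 / (4 * Real.pi * t) := by
  simpa using norm_heatDeriv_le ht le_rfl 0 u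

/-- Each of the heat kernels of a wheel may be estimated by its maximum, after which a tree is
left. The geometric mean of these estimates is integrable in the times if there are at least two
edges. -/
theorem hasHeatBound_of_wheel {d : (X → ℂ) →L[ℂ] (E → ℂ)} (r : X)
    (hker : ∀ z, d z = 0 → z r = 0 → z = 0) (hsum : ∀ z, ∑ e, d z e = 0)
    (hcard : Fintype.card E = Fintype.card X) (L : ℝ) :
    HasHeatBound d L fun τ => ∏ e, τ e ^ (-(1 / Fintype.card E : ℝ)) := by
  classical
  intro F hF hFc
  have hE : 0 < Fintype.card E := hcard ▸ Fintype.card_pos_iff.2 ⟨r⟩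
  choose C hC using fun e₀ => exists_bound_integral_tree (d := deleteEdge d e₀) r
    (fun z hz => hker z (deleteEdge_ker hsum e₀ hz)) (card_deleteEdge hcard e₀)
    hF.continuous hFc
  have hC0 : ∀ e, 0 ≤ C e := fun e => le_trans
    (integral_nonneg fun z => by positivity) (hC e (fun _ => 1) fun _ => one_pos)
  let D : ℝ := ∑ e, C e
  have hCD : ∀ e, C e ≤ D := fun e =>
    Finset.single_le_sum (fun e _ => hC0 e) (Finset.mem_univ e)
  have hD : 0 ≤ D := Finset.sum_nonneg fun e _ => hC0 e
  refine ⟨D, fun τ hτ => ?_⟩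
  set I := ‖∫ z, F z * heatProd d 0 τ z‖
  have hI : ∀ e, I ≤ D * (τ e)⁻¹ := fun e => by
    have hpos : 0 < τ e := (hτ e).1
    have hcont : ∀ e', Continuous fun z => d z e' := fun e' =>
      (continuous_apply e').comp d.continuous
    have hk : ∀ e', Continuous fun z => ‖heatDeriv 0 (τ e') (d z e')‖ := fun e' =>
      ((contDiff_heatDeriv 0 _).continuous.comp (hcont e')).norm
    calc I ≤ ∫ z, ‖F z * heatProd d 0 τ z‖ := norm_integral_le_integral_norm _
      _ ≤ ∫ z, (1 / (4 * Real.pi * τ e)) * (‖F z‖ *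
            ∏ e' : {e' // e' ≠ e}, ‖heatDeriv 0 (τ e') (deleteEdge d e z e')‖) := by
          refine integral_mono_of_nonneg (ae_of_all _ fun z => norm_nonneg _)
            (Integrable.const_mul (Continuous.integrable_of_hasCompactSupport ?_
              hFc.norm.mul_right) _) (ae_of_all _ fun z => ?_)
          · exact hF.continuous.norm.mul (continuous_finsetProd _ fun e' _ => hk e')
          · simp only [norm_mul, heatProd, norm_prod]
            rw [Fintype.prod_eq_mul_prod_subtype_ne _ e, mul_left_comm]
            exact mul_le_mul_of_nonneg_right (norm_heatDeriv_zero_le hpos _) (by positivity)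
      _ ≤ (1 / (4 * Real.pi * τ e)) * C e := by
          rw [integral_const_mul]
          exact mul_le_mul_of_nonneg_left (hC e (fun e' => τ e') fun e' => (hτ e').1)
            (by positivity)
      _ ≤ (1 / τ e) * D := by
          have h1 := hCD e
          have h2 : τ e ≤ 4 * Real.pi * τ e := by nlinarith [Real.pi_gt_three]
          have h3 := hC0 e
          gcongr
      _ = D * (τ e)⁻¹ := by rw [one_div, mul_comm]
  have hN : (Fintype.card E : ℝ) ≠ 0 := Nat.cast_ne_zero.2 hE.ne'
  have hprod : ∀ x : ℝ, 0 ≤ x → ∏ _e : E, x ^ (1 / Fintype.card E : ℝ) = x := fun x hx => by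
    rw [Finset.prod_const, Finset.card_univ, ← Real.rpow_natCast, ← Real.rpow_mul hx,
      one_div_mul_cancel hN, Real.rpow_one]
  calc I = ∏ _e : E, I ^ (1 / Fintype.card E : ℝ) := (hprod I (norm_nonneg _)).symm
    _ ≤ ∏ e, (D * (τ e)⁻¹) ^ (1 / Fintype.card E : ℝ) :=
        Finset.prod_le_prod (fun _ _ => by positivity) fun e _ =>
          Real.rpow_le_rpow (norm_nonneg _) (hI e) (by positivity)
    _ = D * ∏ e, τ e ^ (-(1 / Fintype.card E : ℝ)) := by
        rw [← hprod D hD, hprod D hD, ← hprod D hD, ← Finset.prod_mul_distrib]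
        refine Finset.prod_congr rfl fun e _ => ?_
        rw [hprod D hD, Real.mul_rpow hD (inv_nonneg.2 (hτ e).1.le),
          Real.inv_rpow (hτ e).1.le, Real.rpow_neg (hτ e).1.le]

theorem isRegular_of_wheel {d : (X → ℂ) →L[ℂ] (E → ℂ)} (r : X)
    (hker : ∀ z, d z = 0 → z r = 0 → z = 0) (hsum : ∀ z, ∑ e, d z e = 0)
    (hcard : Fintype.card E = Fintype.card X) (h2 : 2 ≤ Fintype.card E) {L : ℝ} (hL : 0 < L)
    (m : E → ℕ) {F : (X → ℂ) → ℂ} (hF : ContDiff ℝ ∞ F) (hFc : HasCompactSupport F) :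
    IsRegular L fun ℓ z => F z * ∏ e, ∫ t in Ioc ℓ L, heatDeriv (m e) t (d z e) := by
  refine isRegular_of_hasHeatBound (hasHeatBound_of_wheel r hker hsum hcard L)
    (hasBoundedLifts_of_wheel r hker hsum hcard) ?_ m hF hFc
  rw [IntegrableOn, volume_pi, Measure.restrict_pi_pi]
  have h2' : (2 : ℝ) ≤ Fintype.card E := by exact_mod_cast h2
  refine Integrable.fintype_prod (f := fun _ t => t ^ (-(1 / Fintype.card E : ℝ))) fun e => ?_
  have h := intervalIntegral.intervalIntegrable_rpow' (a := 0) (b := L)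
    (r := -(1 / Fintype.card E : ℝ)) (by
      rw [neg_lt_neg_iff, div_lt_one (by linarith)]; linarith)
  exact (intervalIntegrable_iff_integrableOn_Ioc_of_le hL.le).1 h

end Wheel

/-! ### The inputs -/

section Inputs

theorem contDiff_dz {f : ℂ → ℂ} (hf : ContDiff ℝ ∞ f) : ContDiff ℝ ∞ (dz f) := by
  have h : ∀ b : ℂ, ContDiff ℝ ∞ fun z => fderiv ℝ f z b := fun b =>
    (hf.fderiv_right (m := ∞) (by simp)).clm_apply contDiff_const
  exact ((h 1).sub (contDiff_const.mul (h _))).div_const 2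

theorem hasCompactSupport_dz {f : ℂ → ℂ} (hf : HasCompactSupport f) :
    HasCompactSupport (dz f) := by
  refine hf.fderiv (𝕜 := ℝ) |>.mono fun z hz => ?_
  contrapose! hz
  simp only [Function.mem_support, not_not] at hz
  simp [dz, hz]

theorem dz_add {f g : ℂ → ℂ} (hf : ContDiff ℝ ∞ f) (hg : ContDiff ℝ ∞ g) :
    dz (f + g) = dz f + dz g := by
  ext x
  rw [Pi.add_apply, dz, fderiv_add (hf.differentiable (by simp) x) (hg.differentiable (by simp) x)]
  simp only [dz, add_apply]
  ring

theorem dz_smul {f : ℂ → ℂ} (c : ℂ) (hf : ContDiff ℝ ∞ f) : dz (c • f) = c • dz f := by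
  ext x
  rw [Pi.smul_apply, dz, fderiv_const_smul (hf.differentiable (by simp) x)]
  simp only [dz, smul_apply, smul_eq_mul]
  ring

variable {V ι : Type*} [NormedAddCommGroup V] [NormedSpace ℂ V]

theorem contDiff_coefficient [Finite ι] (e : Module.Basis ι ℂ V) (φ : Fields V) (q : Fin 2)
    (k : FieldKind) (i : Option ι) : ContDiff ℝ ∞ (coefficient e φ q k i) := by
  have hV : FiniteDimensional ℂ V := e.finiteDimensional_of_finite
  match k, i with
  | .gamma, some i =>
    exact (((e.coord i).toContinuousLinearMap).restrictScalars ℝ).contDiff.comp (φ.1.2 q).1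
  | .beta, some i =>
    exact ((ContinuousLinearMap.apply ℂ ℂ (e i)).restrictScalars ℝ).contDiff.comp (φ.2.1.2 q).1
  | .gamma, none => exact contDiff_const
  | .beta, none => exact contDiff_const
  | .c, _ => exact (φ.2.2.1.2 q).1
  | .b, _ => exact (φ.2.2.2.2 q).1

theorem hasCompactSupport_coefficient (e : Module.Basis ι ℂ V) (φ : Fields V) (q : Fin 2)
    (k : FieldKind) (i : Option ι) : HasCompactSupport (coefficient e φ q k i) := by
  match k, i with
  | .gamma, some i =>
    exact (φ.1.2 q).2.comp_left (g := fun v : V => e.repr v i) (by simp)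
  | .beta, some i =>
    exact (φ.2.1.2 q).2.comp_left (g := fun v : V →L[ℂ] ℂ => v (e i)) (by simp)
  | .gamma, none => exact HasCompactSupport.zero
  | .beta, none => exact HasCompactSupport.zero
  | .c, _ => exact (φ.2.2.1.2 q).2
  | .b, _ => exact (φ.2.2.2.2 q).2

theorem coefficient_add (e : Module.Basis ι ℂ V) (φ ψ : Fields V) (q : Fin 2) (k : FieldKind)
    (i : Option ι) :
    coefficient e (φ + ψ) q k i = coefficient e φ q k i + coefficient e ψ q k i := by
  ext x
  rcases k <;> rcases i <;> simp [coefficient]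

theorem coefficient_smul (e : Module.Basis ι ℂ V) (c : ℂ) (φ : Fields V) (q : Fin 2)
    (k : FieldKind) (i : Option ι) :
    coefficient e (c • φ) q k i = c • coefficient e φ q k i := by
  ext x
  rcases k <;> rcases i <;> simp [coefficient]

end Inputs

namespace StringGraph

variable (Γ : StringGraph)

/-! ### Edges of string graphs -/

/-- The internal edges, labelled by the vertex at which they start. -/
abbrev Edge : Type := {v : Fin Γ.n // Γ.flip (v, 0) ≠ (v, 0)}

/-- The incoming half-edge at which an internal edge ends. -/
def head (e : Γ.Edge) : Γ.HalfEdge := Γ.flip (e.1, 0)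

theorem card_edge : Fintype.card Γ.Edge = Γ.numEdges := Fintype.card_subtype _

variable {Γ}

theorem flip_ne {h : Γ.HalfEdge} (hh : Γ.flip h ≠ h) : Γ.flip (Γ.flip h) ≠ Γ.flip h := by
  rw [Γ.flip_flip]; exact hh.symm

theorem flip_snd_eq_zero_iff {h : Γ.HalfEdge} (hh : Γ.flip h ≠ h) :
    (Γ.flip h).2 = 0 ↔ h.2 ≠ 0 := by
  have key : ∀ (k k' : VertexKind) (s s' : Fin 3), (k.field s, k'.field s') ∈
      ({(.beta, .gamma), (.gamma, .beta), (.b, .c), (.c, .b)} : Set (FieldKind × FieldKind)) →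
      (s' = 0 ↔ s ≠ 0) := by
    intro k k' s s'
    cases k <;> cases k' <;> fin_cases s <;> fin_cases s' <;> simp [VertexKind.field]
  exact key _ _ _ _ (Γ.edge_kind h hh)

theorem head_snd_ne_zero (e : Γ.Edge) : (Γ.head e).2 ≠ 0 := fun h =>
  (flip_snd_eq_zero_iff e.2).1 h rfl

theorem flip_head_ne (e : Γ.Edge) : Γ.flip (Γ.head e) ≠ Γ.head e := flip_ne e.2

theorem flip_head (e : Γ.Edge) : Γ.flip (Γ.head e) = (e.1, 0) := Γ.flip_flip _

theorem head_injective : Function.Injective Γ.head := fun e e' h => by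
  have := congrArg Γ.flip h
  rw [flip_head, flip_head] at this
  exact Subtype.ext (congrArg Prod.fst this)

/-- Every internal half-edge which is not outgoing is the head of an edge. -/
theorem exists_head_eq {h : Γ.HalfEdge} (hh : Γ.flip h ≠ h) (h0 : h.2 ≠ 0) :
    ∃ e, Γ.head e = h := by
  have h1 : Γ.flip h = ((Γ.flip h).1, 0) := Prod.ext rfl ((flip_snd_eq_zero_iff hh).2 h0)
  have h2 : Γ.flip ((Γ.flip h).1, 0) = h := by rw [← h1, Γ.flip_flip]
  refine ⟨⟨(Γ.flip h).1, ?_⟩, h2⟩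
  rw [h2, ← h1]
  exact hh.symm

variable (Γ) in
/-- The difference of the positions of the two ends of every edge. -/
noncomputable def edgeDiff : (Fin Γ.n → ℂ) →L[ℂ] (Γ.Edge → ℂ) :=
  ContinuousLinearMap.pi fun e =>
    ContinuousLinearMap.proj (R := ℂ) (φ := fun _ => ℂ) e.1 - ContinuousLinearMap.proj (Γ.head e).1

theorem edgeDiff_apply (z : Fin Γ.n → ℂ) (e : Γ.Edge) :
    Γ.edgeDiff z e = z e.1 - z (Γ.head e).1 := rfl

/-- In a connected graph the edge differences determine the positions up to translation. -/
theorem eq_of_edgeDiff_eq_zero (hΓ : Γ.adjacency.Connected) {z : Fin Γ.n → ℂ}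
    (hz : Γ.edgeDiff z = 0) (v w : Fin Γ.n) : z v = z w := by
  have hz' : ∀ e : Γ.Edge, z e.1 = z (Γ.head e).1 := fun e => sub_eq_zero.1 (congrFun hz e)
  have h1 : ∀ v w : Fin Γ.n, v ≠ w → (∃ s s', Γ.flip (v, s) = (w, s')) → z v = z w := by
    rintro v w hvw ⟨s, s', h⟩
    have hne : Γ.flip (v, s) ≠ (v, s) := fun h' => hvw (congrArg Prod.fst (h'.symm.trans h))
    by_cases hs : s = 0
    · subst hs
      have := hz' ⟨v, hne⟩
      rwa [head, h] at this
    · obtain ⟨e, he⟩ := exists_head_eq hne hs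
      have h2 := flip_head e
      rw [he, h] at h2
      have := hz' e
      rw [he, show e.1 = w from (congrArg Prod.fst h2).symm] at this
      exact this.symm
  have h2 : ∀ v w, Γ.adjacency.Adj v w → z v = z w := fun v w h => by
    obtain ⟨hvw, h | h⟩ := (SimpleGraph.fromRel_adj _ _ _).1 h
    · exact h1 v w hvw h
    · exact (h1 w v hvw.symm h).symm
  obtain ⟨p⟩ := hΓ.preconnected v w
  induction p with
  | nil => rfl
  | cons h _ ih => exact (h2 _ _ h).trans ih

/-- If every vertex of a one-loop graph carries an external leg, then every vertex has exactly one
incoming internal edge, so the graph is a wheel. -/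
theorem bijective_of_legs (hΓ : Γ.numEdges = Γ.n) (hl : ∀ v, ∃ l : Γ.Leg, l.1.1 = v) :
    (Function.Bijective fun e : Γ.Edge => e.1) ∧
      Function.Bijective fun e : Γ.Edge => (Γ.head e).1 := by
  have hcard : Fintype.card Γ.Edge = Fintype.card (Fin Γ.n) := by
    rw [card_edge, hΓ, Fintype.card_fin]
  have h1 : Function.Bijective fun e : Γ.Edge => e.1 :=
    (Fintype.bijective_iff_injective_and_card _).2 ⟨Subtype.val_injective, hcard⟩
  refine ⟨h1, (Fintype.bijective_iff_injective_and_card _).2 ⟨fun e e' h => ?_, hcard⟩⟩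
  refine head_injective (Prod.ext h ?_)
  obtain ⟨⟨⟨u, t⟩, hl⟩, hu⟩ := hl (Γ.head e).1
  simp only at h hu
  have ht0 : t ≠ 0 := by
    rintro rfl
    obtain ⟨f, hf⟩ := h1.2 u
    exact f.2 (by rw [show f.1 = u from hf]; exact hl)
  have hte : (Γ.head e).2 ≠ t := by
    rintro rfl
    subst hu
    exact flip_head_ne e hl
  have hte' : (Γ.head e').2 ≠ t := by
    rintro rfl
    rw [h] at hu
    subst hu
    exact flip_head_ne e' hl
  have h2 := head_snd_ne_zero e
  have h3 := head_snd_ne_zero e'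
  omega

/-- The regularised integrals of a tree or a one-loop graph all of whose vertices carry legs
converge. -/
theorem isRegular_edges (hΓ : Γ.IsTree ∨ Γ.IsOneLoop) (hl : ∀ v, ∃ l : Γ.Leg, l.1.1 = v)
    {L : ℝ} (hL : 0 < L) {m : Γ.Edge → ℕ} (hm : ∀ e, m e ≠ 0) {F : (Fin Γ.n → ℂ) → ℂ}
    (hF : ContDiff ℝ ∞ F) (hFc : HasCompactSupport F) :
    IsRegular L fun ℓ z => F z * ∏ e, ∫ t in Ioc ℓ L, heatDeriv (m e) t (Γ.edgeDiff z e) := by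
  have hconn : Γ.adjacency.Connected := hΓ.elim And.left And.left
  obtain ⟨r⟩ := hconn.nonempty
  have hker : ∀ z, Γ.edgeDiff z = 0 → z r = 0 → z = 0 := fun z hz hr =>
    funext fun v => (eq_of_edgeDiff_eq_zero hconn hz v r).trans hr
  rcases hΓ with ⟨-, hn⟩ | ⟨-, hn⟩
  · exact isRegular_of_tree r hker (by rw [card_edge, hn, Fintype.card_fin]) L m hF hFc
  · have hcard : Fintype.card Γ.Edge = Γ.n := by rw [card_edge, hn]
    obtain ⟨h1, h2⟩ := bijective_of_legs hn hl
    by_cases hn2 : 2 ≤ Γ.n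
    · refine isRegular_of_wheel r hker (fun z => ?_) (by rw [hcard, Fintype.card_fin])
        (by rw [hcard]; exact hn2) hL m hF hFc
      simp only [edgeDiff_apply]
      rw [Finset.sum_sub_distrib, h1.sum_comp z, h2.sum_comp z, sub_self]
    · -- A single vertex with a self-loop: the propagator and its derivative vanish on the diagonal.
      have : Subsingleton (Fin Γ.n) := Fin.subsingleton_iff_le_one.2 (by omega)
      obtain ⟨e, -⟩ := h1.2 r
      refine (isRegular_zero L).congr hL fun ℓ _ _ => funext fun z => ?_
      rw [Finset.prod_eq_zero (Finset.mem_univ e), mul_zero]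
      rw [edgeDiff_apply, Subsingleton.elim (Γ.head e).1 e.1, sub_self]
      simp [heatDeriv_zero_right (hm e)]

/-! ### Expansion of the integrand -/

/-- The coefficient in the interaction of the term in which `∂_z` acts on the first, respectively
the second, incoming field. -/
def vertexCoeff : VertexKind → Fin 2 → ℂ
  | .matter => ![0, 1]
  | .ghost => ![-1, 1]

theorem vertexValue_eq_sum (k : VertexKind) (f : Fin 3 → ℂ → ℂ) (x : ℂ) :
    vertexValue k f x = ∑ j, vertexCoeff k j *
      ∏ s : Fin 3, (if s = j.succ then dz (f s) else f s) x := by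
  cases k <;> simp [vertexValue, vertexCoeff, Fin.sum_univ_two, Fin.prod_univ_three] <;> ring

/-- The function `f` supplied by the half-edge `h`, or `∂_z f` if `j` selects `h` as the incoming
half-edge on which `∂_z` acts at its vertex. -/
noncomputable def derivAt (j : Fin Γ.n → Fin 2) (h : Γ.HalfEdge) (f : ℂ → ℂ) : ℂ → ℂ :=
  if h.2 = (j h.1).succ then dz f else f

/-- The number of heat kernel factors `conj u / (4 * t)` carried by an edge. -/
def edgeOrder (j : Fin Γ.n → Fin 2) (e : Γ.Edge) : ℕ :=
  if (Γ.head e).2 = (j (Γ.head e).1).succ then 2 else 1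

theorem edgeOrder_ne_zero (j : Fin Γ.n → Fin 2) (e : Γ.Edge) : edgeOrder j e ≠ 0 := by
  unfold edgeOrder; split_ifs <;> simp

theorem derivAt_propagator (j : Fin Γ.n → Fin 2) (e : Γ.Edge) {ℓ L : ℝ} (hℓ : 0 < ℓ) (hL : ℓ ≤ L)
    (z w : ℂ) : derivAt j (Γ.head e) (propagator ℓ L z) w =
      2 * ∫ t in Ioc ℓ L, heatDeriv (edgeOrder j e) t (z - w) := by
  unfold derivAt edgeOrder
  split_ifs
  · exact dz_propagator hℓ hL z w
  · exact propagator_eq hL z w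

variable {V ι : Type*} [NormedAddCommGroup V] [NormedSpace ℂ V]

/-- The function with which the input at the leg `l` enters the term selected by `j`. -/
noncomputable def legValue (e : Module.Basis ι ℂ V) (q : Γ.Leg → Fin 2) (a : Fin Γ.n → Option ι)
    (j : Fin Γ.n → Fin 2) (l : Γ.Leg) (φ : Fields V) : ℂ → ℂ :=
  derivAt j l.1 (coefficient e φ (q l) (Γ.field l.1) (a l.1.1))

/-- The product of the vertex operators, expanded into contributions of legs and edges. -/
theorem prod_vertexValue (P : ℂ → ℂ → ℂ) (e : Module.Basis ι ℂ V) (φ : Γ.Leg → Fields V)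
    (q : Γ.Leg → Fin 2) (a : Fin Γ.n → Option ι) (z : Fin Γ.n → ℂ) :
    ∏ v, vertexValue (Γ.kind v) (fun s => Γ.slot P e φ q a z (v, s)) (z v) =
      ∑ j : Fin Γ.n → Fin 2, (∏ v, vertexCoeff (Γ.kind v) (j v)) *
        ((∏ l : Γ.Leg, legValue e q a j l (φ l) (z l.1.1)) *
          ∏ x : Γ.Edge, derivAt j (Γ.head x) (P (z x.1)) (z (Γ.head x).1)) := by
  simp only [vertexValue_eq_sum]
  rw [Finset.prod_univ_sum, Fintype.piFinset_univ]
  refine Finset.sum_congr rfl fun j _ => ?_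
  rw [Finset.prod_mul_distrib]
  congr 1
  let Y : Γ.HalfEdge → ℂ := fun h => derivAt j h (Γ.slot P e φ q a z h) (z h.1)
  have h1 : ∏ v, ∏ s : Fin 3, (if s = (j v).succ then dz (Γ.slot P e φ q a z (v, s))
      else Γ.slot P e φ q a z (v, s)) (z v) = ∏ h, Y h :=
    (Fintype.prod_prod_type Y).symm
  rw [h1, ← Fintype.prod_subtype_mul_prod_subtype (fun h => Γ.flip h = h) Y]
  congr 1
  · refine Finset.prod_congr rfl fun l _ => ?_
    simp only [Y, legValue, slot, l.2, dif_pos]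
  · refine (Fintype.prod_of_injective (fun x : Γ.Edge => (⟨Γ.head x, flip_head_ne x⟩ :
      {h : Γ.HalfEdge // ¬Γ.flip h = h})) (fun x y h => head_injective (congrArg Subtype.val h))
      _ _ (fun h hh => ?_) fun x => ?_).symm
    · have h0 : h.1.2 = 0 := by
        by_contra h0
        obtain ⟨x, hx⟩ := exists_head_eq h.2 h0
        exact hh ⟨x, Subtype.ext hx⟩
      have h3 : ¬(h.1.2 = (j h.1.1).succ) := by
        rw [h0]; exact (Fin.succ_ne_zero _).symm
      simp only [Y, derivAt, if_neg h3, slot, dif_neg h.2, if_pos h0]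
    · simp only [Y]
      rw [slot, dif_neg (flip_head_ne x), if_neg (head_snd_ne_zero x), flip_head]

theorem hasCompactSupport_legValue (e : Module.Basis ι ℂ V) (q : Γ.Leg → Fin 2)
    (a : Fin Γ.n → Option ι) (j : Fin Γ.n → Fin 2) (l : Γ.Leg) (φ : Fields V) :
    HasCompactSupport (legValue e q a j l φ) := by
  unfold legValue derivAt
  split_ifs
  · exact hasCompactSupport_dz (hasCompactSupport_coefficient _ _ _ _ _)
  · exact hasCompactSupport_coefficient _ _ _ _ _

theorem hasCompactSupport_prod_legValue (e : Module.Basis ι ℂ V) (q : Γ.Leg → Fin 2)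
    (a : Fin Γ.n → Option ι) (j : Fin Γ.n → Fin 2) (hl : ∀ v, ∃ l : Γ.Leg, l.1.1 = v)
    (φ : Γ.Leg → Fields V) :
    HasCompactSupport fun z : Fin Γ.n → ℂ => ∏ l : Γ.Leg, legValue e q a j l (φ l) (z l.1.1) := by
  choose l hl using hl
  refine HasCompactSupport.intro (isCompact_univ_pi fun v =>
    (hasCompactSupport_legValue e q a j (l v) (φ (l v))).isCompact) fun z hz => ?_
  simp only [mem_univ_pi, not_forall] at hz
  obtain ⟨v, hv⟩ := hz
  refine Finset.prod_eq_zero (Finset.mem_univ (l v)) ?_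
  rw [hl]
  exact image_eq_zero_of_notMem_tsupport hv

variable [Fintype ι]

theorem contDiff_legValue (e : Module.Basis ι ℂ V) (q : Γ.Leg → Fin 2) (a : Fin Γ.n → Option ι)
    (j : Fin Γ.n → Fin 2) (l : Γ.Leg) (φ : Fields V) : ContDiff ℝ ∞ (legValue e q a j l φ) := by
  unfold legValue derivAt
  split_ifs
  · exact contDiff_dz (contDiff_coefficient _ _ _ _ _)
  · exact contDiff_coefficient _ _ _ _ _

/-- The input at a leg enters the weight linearly. -/
noncomputable def legFunctional (e : Module.Basis ι ℂ V) (q : Γ.Leg → Fin 2)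
    (a : Fin Γ.n → Option ι) (j : Fin Γ.n → Fin 2) (l : Γ.Leg) (x : ℂ) : Fields V →ₗ[ℂ] ℂ where
  toFun φ := legValue e q a j l φ x
  map_add' φ ψ := by
    simp only [legValue, derivAt, coefficient_add]
    split_ifs
    · rw [dz_add (contDiff_coefficient _ _ _ _ _) (contDiff_coefficient _ _ _ _ _)]; rfl
    · rfl
  map_smul' c φ := by
    simp only [legValue, derivAt, coefficient_smul]
    split_ifs
    · rw [dz_smul c (contDiff_coefficient _ _ _ _ _)]; rfl
    · rfl

theorem contDiff_prod_legValue (e : Module.Basis ι ℂ V) (q : Γ.Leg → Fin 2)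
    (a : Fin Γ.n → Option ι) (j : Fin Γ.n → Fin 2) (φ : Γ.Leg → Fields V) :
    ContDiff ℝ ∞ fun z : Fin Γ.n → ℂ => ∏ l : Γ.Leg, legValue e q a j l (φ l) (z l.1.1) :=
  contDiff_prod fun l _ => (contDiff_legValue e q a j l (φ l)).comp (contDiff_apply ℝ ℂ l.1.1)

theorem isRegular_integrand (e : Module.Basis ι ℂ V) (hΓ : Γ.IsTree ∨ Γ.IsOneLoop) {L : ℝ}
    (hL : 0 < L) (φ : Γ.Leg → Fields V) :
    IsRegular L fun ℓ => Γ.integrand (propagator ℓ L) e φ := by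
  classical
  unfold integrand
  refine IsRegular.const_mul (IsRegular.sum hL _ fun q hq => IsRegular.const_mul
    (IsRegular.sum hL _ fun a _ => ?_) _) _
  -- A top form has an input of form degree one at every vertex.
  have hl : ∀ v, ∃ l : Γ.Leg, l.1.1 = v := fun v => by
    obtain ⟨l, hl, -⟩ := (Finset.mem_filter.1 hq).2 v
    exact ⟨l, hl.1⟩
  simp only [prod_vertexValue]
  refine IsRegular.sum hL _ fun j _ => IsRegular.const_mul ?_ _
  refine ((isRegular_edges hΓ hl hL (edgeOrder_ne_zero j) (contDiff_prod_legValue e q a j φ)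
    (hasCompactSupport_prod_legValue e q a j hl φ)).const_mul
      (2 ^ Fintype.card Γ.Edge)).congr hL fun ℓ h0 h1 => funext fun z => ?_
  simp only [derivAt_propagator j _ h0 h1.le, edgeDiff_apply]
  rw [Finset.prod_mul_distrib, Finset.prod_const, Finset.card_univ]
  ring

theorem exists_multilinearMap_integrand (P : ℂ → ℂ → ℂ) (e : Module.Basis ι ℂ V)
    (z : Fin Γ.n → ℂ) :
    ∃ M : MultilinearMap ℂ (fun _ : Γ.Leg => Fields V) ℂ, ∀ φ, Γ.integrand P e φ z = M φ := by
  classical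
  let N (q : Γ.Leg → Fin 2) (a : Fin Γ.n → Option ι) (j : Fin Γ.n → Fin 2) :
      MultilinearMap ℂ (fun _ : Γ.Leg => Fields V) ℂ :=
    (MultilinearMap.mkPiAlgebra ℂ Γ.Leg ℂ).compLinearMap
      fun l => legFunctional e q a j l (z l.1.1)
  refine ⟨(Γ.contractionSign : ℂ) • ∑ q ∈ Finset.univ.filter Γ.IsTopDegree,
    (Γ.inputSign q : ℂ) • ∑ a ∈ Finset.univ.filter fun a : Fin Γ.n → Option ι => Γ.IsIndexing a,
      ∑ j : Fin Γ.n → Fin 2, ((∏ v, vertexCoeff (Γ.kind v) (j v)) *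
        ∏ x : Γ.Edge, derivAt j (Γ.head x) (P (z x.1)) (z (Γ.head x).1)) • N q a j, fun φ => ?_⟩
  have hN : ∀ q a j, N q a j φ = ∏ l : Γ.Leg, legValue e q a j l (φ l) (z l.1.1) := fun q a j => by
    simp only [N, MultilinearMap.compLinearMap_apply, MultilinearMap.mkPiAlgebra_apply]
    rfl
  simp only [smul_apply, sum_apply, hN, smul_eq_mul, integrand,
    prod_vertexValue]
  refine congrArg _ (Finset.sum_congr (by congr!) fun q _ => congrArg _
    (Finset.sum_congr (by congr!) fun a _ => Finset.sum_congr rfl fun j _ => ?_))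
  ring

theorem integrand_update_add [DecidableEq Γ.Leg] (P : ℂ → ℂ → ℂ) (e : Module.Basis ι ℂ V)
    (φ : Γ.Leg → Fields V) (l : Γ.Leg) (x y : Fields V) (z : Fin Γ.n → ℂ) :
    Γ.integrand P e (Function.update φ l (x + y)) z =
      Γ.integrand P e (Function.update φ l x) z + Γ.integrand P e (Function.update φ l y) z := by
  obtain ⟨M, hM⟩ := exists_multilinearMap_integrand P e z
  simp only [hM, M.map_update_add]

theorem integrand_update_smul [DecidableEq Γ.Leg] (P : ℂ → ℂ → ℂ) (e : Module.Basis ι ℂ V)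
    (φ : Γ.Leg → Fields V) (l : Γ.Leg) (c : ℂ) (x : Fields V) (z : Fin Γ.n → ℂ) :
    Γ.integrand P e (Function.update φ l (c • x)) z =
      c * Γ.integrand P e (Function.update φ l x) z := by
  obtain ⟨M, hM⟩ := exists_multilinearMap_integrand P e z
  simp only [hM, M.map_update_smul, smul_eq_mul]

end StringGraph

end HolomorphicString

open Filter Topology MeasureTheory HolomorphicString in
theorem mainTheorem3 {V ι : Type*} [NormedAddCommGroup V] [NormedSpace ℂ V] [Fintype ι]
    (e : Module.Basis ι ℂ V) (Γ : StringGraph) (hΓ : Γ.IsTree ∨ Γ.IsOneLoop)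
    (L : ℝ) (hL : 0 < L) :
    (∀ ℓ : ℝ, 0 < ℓ → ℓ < L → ∀ φ : Γ.Leg → Fields V,
      Integrable (Γ.integrand (propagator ℓ L) e φ)) ∧
    ∃ W : MultilinearMap ℂ (fun _ : Γ.Leg => Fields V) ℂ, ∀ φ : Γ.Leg → Fields V,
      Tendsto (fun ℓ : ℝ => Γ.weight (propagator ℓ L) e φ) (𝓝[>] 0) (𝓝 (W φ)) := by
  have hreg := fun φ : Γ.Leg → Fields V => StringGraph.isRegular_integrand e hΓ hL φ
  refine ⟨fun ℓ h0 h1 φ => (hreg φ).1 ℓ h0 h1, ?_⟩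
  have hlim : ∀ φ : Γ.Leg → Fields V, ∃ w, Tendsto
      (fun ℓ : ℝ => Γ.weight (propagator ℓ L) e φ) (𝓝[>] 0) (𝓝 w) := fun φ => by
    obtain ⟨w, hw⟩ := (hreg φ).2
    exact ⟨_, hw.const_mul _⟩
  choose W hW using hlim
  -- The limit is multilinear because the regularised weights are.
  refine ⟨{ toFun := W, map_update_add' := ?_, map_update_smul' := ?_ }, hW⟩
  · intro _ φ l x y
    refine tendsto_nhds_unique (hW _) (((hW _).add (hW _)).congr' ?_)
    filter_upwards [Ioo_mem_nhdsGT hL] with ℓ hℓ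
    simp only [StringGraph.weight, StringGraph.integrand_update_add]
    rw [integral_add ((hreg _).1 ℓ hℓ.1 hℓ.2) ((hreg _).1 ℓ hℓ.1 hℓ.2), mul_add]
  · intro _ φ l c x
    refine tendsto_nhds_unique (hW _) (((hW _).const_mul c).congr fun ℓ => ?_)
    simp only [StringGraph.weight, StringGraph.integrand_update_smul]
    rw [integral_const_mul]
    ring
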